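/- Let $m\ge 1$ be an integer, let $k$ be a commutative Noetherian ring, and let $\mathscr{FI}^m$ be the $m$-fold product of the category $\mathscr{FI}$ whose objects are the sets $[n]=\{1,\dots,n\}$, $n\in\mathbb N=\{0,1,2,\dots\}$, and whose morphisms are the injections. An $\mathscr{FI}^m$-module $V$ is a functor from $\mathscr{FI}^m$ to $k$-modules; write $V_{\mathbf n}$ for its value at $[n_1]\times\dots\times[n_m]$ if $\mathbf n\in\mathbb N^m$, and $V_{\mathbf n}=0$ if $\mathbf n\in\mathbb Z^m\setminus\mathbb N^m$. It is finitely generated if there are finitely many elements of $\bigsqcup_{\mathbf n}V_{\mathbf n}$ that are not all contained in any proper submodule. A transition map of $V$ is a map induced by a non-invertible morphism of $\mathscr{FI}^m$. The $\mathscr{FI}^m$-homology functors $H_i$ are the left derived functors of $V\mapsto H_0(V)$, $H_0(V)_{\mathbf n}=V_{\mathbf n}/V_{<\mathbf n}$, where $V_{<\mathbf n}\subseteq V_{\mathbf n}$ is the $k$-submodule generated by the images of all transition maps into $V_{\mathbf n}$. The local cohomology functors $H^i_B$ are the right derived functors of the functor sending $V$ to its submodule $V_T$ of $B$-torsion elements,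 that is, of all elements $v\in V_{\mathbf n}$ lying in the kernel of some transition map out of $V_{\mathbf n}$. For $\mathbf a\in\mathbb N^m$ put $|\mathbf a|=\sum_j a_j$, and let $e_1,\dots,e_m$ be the standard basis vectors. Define $$\mathrm{HD}_i(V)=\Big\{\mathbf r\in\mathbb Z^m : H_i(V)_{\mathbf n}=0\text{ for all }\mathbf n\in\bigcup_{j}(\mathbf r+e_j+\mathbb N^m)\Big\},$$ $$\mathrm{CMreg}_+(V)=\Big\{\mathbf r\in\mathbb Z^m : H^i_B(V)_{\mathbf n}=0\text{ for all } i\ge 0\text{ and all }\mathbf n\in\bigcup_{\mathbf a\in\mathbb N^m,\,|\mathbf a|=i}\ \bigcup_j(\mathbf r-\mathbf a+e_j+\mathbb N^m)\Big\}.$$ Theorem. Let $V$ be a finitely generated $\mathscr{FI}^m$-module over $k$, let $i\ge 1$, and let $\mathbf c_i\in\mathbb Z^m$ be a vector such that $\mathbf c_i-\mathbf a\in\mathrm{CMreg}_+(V)$ for every $\mathbf a\in\mathbb N^m$ with $|\mathbf a|=i$. Then $\mathbf c_i\in\mathrm{HD}_i(V)$. -/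

import Mathlib

open CategoryTheory CategoryTheory.Limits

universe u

/-- The category `FI`: its objects are the finite sets `[n]`, `n ∈ ℕ`, and its morphisms are the
injections. The object `[n]` is recorded by its cardinality and realised as `Fin n`. -/
structure FI : Type where
  /-- the cardinality of the object -/
  card : ℕ

instance : Category.{0} FI where
  Hom a b := Fin a.card ↪ Fin b.card
  id a := Function.Embedding.refl (Fin a.card)
  comp f g := Function.Embedding.trans f g

/-- The underlying injection of a morphism of `FI`. -/
def FI.toEmb {a b : FI} (f : a ⟶ b) : Fin a.card ↪ Fin b.card := f

/-- The `m`-fold product category `FI^m`. -/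
abbrev FIProd (m : ℕ) : Type := Fin m → FI

/-- The object `[n] = [n_1] × ⋯ × [n_m]` of `FI^m`. -/
def FIProd.ofVec {m : ℕ} (n : Fin m → ℕ) : FIProd m := fun j => ⟨n j⟩

/-- A morphism `f_1 × ⋯ × f_m` of `FI^m` is non-invertible if some `f_j` is not a bijection; the
maps induced on an `FI^m`-module by such morphisms are the transition maps. -/
def IsTransition {m : ℕ} {a b : FIProd m} (f : a ⟶ b) : Prop :=
  ∃ j, ¬ Function.Bijective (FI.toEmb (f j))

/-- `FI^m`-modules over `k`: functors from `FI^m` to `k`-modules. -/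
abbrev FIMod (k : Type u) [CommRing k] (m : ℕ) : Type (u + 1) := FIProd m ⥤ ModuleCat.{u} k

/-! ### Combinatorics of injections -/

theorem FI.exists_factor {a b c : FI} (f : a ⟶ b) (g : a ⟶ c) (h : b.card ≤ c.card) :
    ∃ t : b ⟶ c, f ≫ t = g := by
  classical
  have e : Nonempty (((Set.range (FI.toEmb f))ᶜ : Set (Fin b.card)) ↪
      ((Set.range (FI.toEmb g))ᶜ : Set (Fin c.card))) := by
    apply Function.Embedding.nonempty_of_card_le
    rw [Fintype.card_compl_set, Fintype.card_compl_set,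
      Set.card_range_of_injective (FI.toEmb f).injective,
      Set.card_range_of_injective (FI.toEmb g).injective]
    simp only [Fintype.card_fin]
    omega
  obtain ⟨e⟩ := e
  let e1 : (Set.range (FI.toEmb f)) ≃ (Set.range (FI.toEmb g)) :=
    (Equiv.ofInjective _ (FI.toEmb f).injective).symm.trans
      (Equiv.ofInjective _ (FI.toEmb g).injective)
  let t : Fin b.card ↪ Fin c.card :=
    ((Equiv.Set.sumCompl (Set.range (FI.toEmb f))).symm.toEmbedding.trans
      (Function.Embedding.sumMap e1.toEmbedding e)).trans
      (Equiv.Set.sumCompl (Set.range (FI.toEmb g))).toEmbedding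
  refine ⟨t, ?_⟩
  apply Function.Embedding.ext
  intro x
  change t (FI.toEmb f x) = FI.toEmb g x
  have hx : (Equiv.Set.sumCompl (Set.range (FI.toEmb f))).symm (FI.toEmb f x) =
      Sum.inl ⟨FI.toEmb f x, x, rfl⟩ :=
    Equiv.Set.sumCompl_symm_apply_of_mem (Set.mem_range_self x)
  have h1 : (Equiv.ofInjective _ (FI.toEmb f).injective).symm ⟨FI.toEmb f x, x, rfl⟩ = x :=
    Equiv.ofInjective_symm_apply (FI.toEmb f).injective x
  simp only [t, Function.Embedding.trans_apply, Equiv.coe_toEmbedding, hx]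
  change (e1 ⟨FI.toEmb f x, x, rfl⟩ : Fin c.card) = _
  simp [e1, h1]

theorem FIProd.exists_factor {m : ℕ} {a b c : FIProd m} (f : a ⟶ b) (g : a ⟶ c)
    (h : ∀ j, (b j).card ≤ (c j).card) : ∃ t : b ⟶ c, f ≫ t = g := by
  choose t ht using fun j => FI.exists_factor (f j) (g j) (h j)
  exact ⟨t, funext ht⟩

theorem FI.card_le {a b : FI} (f : a ⟶ b) : a.card ≤ b.card := by
  simpa using Fintype.card_le_of_embedding (FI.toEmb f)

theorem FI.bijective_iff {a b : FI} (f : a ⟶ b) :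
    Function.Bijective (FI.toEmb f) ↔ a.card = b.card := by
  rw [Fintype.bijective_iff_injective_and_card]
  simp [(FI.toEmb f).injective]

theorem isTransition_iff {m : ℕ} {a b : FIProd m} (f : a ⟶ b) :
    IsTransition f ↔ ∃ j, (a j).card < (b j).card := by
  unfold IsTransition
  refine exists_congr fun j => ?_
  rw [FI.bijective_iff]
  have := FI.card_le (f j)
  omega

theorem IsTransition.comp {m : ℕ} {a b c : FIProd m} {f : a ⟶ b} (hf : IsTransition f)
    (g : b ⟶ c) : IsTransition (f ≫ g) := by
  rw [isTransition_iff] at hf ⊢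
  obtain ⟨j, hj⟩ := hf
  exact ⟨j, lt_of_lt_of_le hj (FI.card_le (g j))⟩

/-- A morphism out of `a` which is large in all directions. -/
theorem FIProd.exists_large {m : ℕ} [NeZero m] (a b c : FIProd m) :
    ∃ (d : FIProd m) (f : a ⟶ d), IsTransition f ∧ (∀ j, (b j).card ≤ (d j).card) ∧
      (∀ j, (c j).card ≤ (d j).card) := by
  let d : FIProd m := fun j => ⟨(a j).card + (b j).card + (c j).card + 1⟩
  let f : a ⟶ d := fun j => (Fin.castLEEmb (by simp only [d]; omega) :
    Fin (a j).card ↪ Fin (d j).card)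
  refine ⟨d, f, ?_, fun j => ?_, fun j => ?_⟩
  · rw [isTransition_iff]
    exact ⟨0, by simp only [d]; omega⟩
  · simp only [d]; omega
  · simp only [d]; omega

/-! ### Submodules and quotient modules of `FI^m`-modules -/

section Modules

variable {k : Type u} [CommRing k] {m : ℕ}

/-- A submodule of an `FI^m`-module: a family of `k`-submodules stable under all induced maps. -/
structure FISub (V : FIMod k m) where
  /-- the value at an object -/
  carrier : ∀ a : FIProd m, Submodule k (V.obj a)
  map_mem : ∀ {a b : FIProd m} (f : a ⟶ b) (v : V.obj a), v ∈ carrier a →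
    (V.map f).hom v ∈ carrier b

/-- A submodule, viewed as an `FI^m`-module. -/
def FISub.toMod {V : FIMod k m} (W : FISub V) : FIMod k m where
  obj a := ModuleCat.of k (W.carrier a)
  map f := ModuleCat.ofHom ((V.map f).hom.restrict (W.map_mem f))
  map_id a := by
    ext x
    exact congrArg (fun t => t.hom x.1) (V.map_id a)
  map_comp f g := by
    ext x
    exact congrArg (fun t => t.hom x.1) (V.map_comp f g)

/-- The quotient of an `FI^m`-module by a submodule. -/
def FISub.quot {V : FIMod k m} (W : FISub V) : FIMod k m where
  obj a := ModuleCat.of k (V.obj a ⧸ W.carrier a)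
  map {a b} f := ModuleCat.ofHom ((W.carrier a).mapQ (W.carrier b) (V.map f).hom (W.map_mem f))
  map_id a := by
    ext x
    simp
  map_comp f g := by
    ext x
    simp

/-- `V` is finitely generated: there are finitely many elements of `⊔_n V_n` which are not all
contained in any proper submodule. -/
def FIMod.IsFG (V : FIMod k m) : Prop :=
  ∃ s : Set (Σ a : FIProd m, V.obj a), s.Finite ∧
    ∀ W : FISub V, (∀ x ∈ s, x.2 ∈ W.carrier x.1) → ∀ a, W.carrier a = ⊤

/-! ### The functor `H_0` and `FI^m`-homology -/

/-- The submodule `V_{<n}` of `V_n` generated by the images of the transition maps into `V_n`. -/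
def FIMod.lt (V : FIMod k m) : FISub V where
  carrier b := Submodule.span k
    {v | ∃ (a : FIProd m) (f : a ⟶ b) (w : V.obj a), IsTransition f ∧ (V.map f).hom w = v}
  map_mem {a b} g v hv := by
    induction hv using Submodule.span_induction with
    | mem v h =>
      obtain ⟨c, f, w, hf, rfl⟩ := h
      exact Submodule.subset_span ⟨c, f ≫ g, w, hf.comp g, by simp⟩
    | zero => simp
    | add x y _ _ hx hy => rw [map_add]; exact add_mem hx hy
    | smul r x _ hx => rw [map_smul]; exact Submodule.smul_mem _ _ hx

theorem FIMod.lt_map {V W : FIMod k m} (φ : V ⟶ W) (a : FIProd m) :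
    (FIMod.lt V).carrier a ≤ ((FIMod.lt W).carrier a).comap (φ.app a).hom := by
  refine Submodule.span_le.2 ?_
  rintro _ ⟨c, f, w, hf, rfl⟩
  refine Submodule.subset_span ⟨c, f, (φ.app c).hom w, hf, ?_⟩
  exact (NatTrans.naturality_apply φ f w).symm

/-- The functor `V ↦ H_0(V)`, `H_0(V)_n = V_n / V_{<n}`. -/
def FIHomZero (k : Type u) [CommRing k] (m : ℕ) : FIMod k m ⥤ FIMod k m where
  obj V := (FIMod.lt V).quot
  map {V W} φ :=
    { app := fun a => ModuleCat.ofHom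
        (((FIMod.lt V).carrier a).mapQ ((FIMod.lt W).carrier a) (φ.app a).hom (FIMod.lt_map φ a))
      naturality := by
        intro a b f
        apply ModuleCat.hom_ext
        apply Submodule.linearMap_qext
        ext x
        have h := NatTrans.naturality_apply φ f x
        exact congrArg (Submodule.Quotient.mk (p := (FIMod.lt W).carrier b)) h }
  map_id V := by
    ext a : 2
    apply ModuleCat.hom_ext
    apply Submodule.linearMap_qext
    rfl
  map_comp φ ψ := by
    ext a : 2
    apply ModuleCat.hom_ext
    apply Submodule.linearMap_qext
    rfl

instance : (FIHomZero k m).Additive where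
  map_add := by
    intros
    ext a : 2
    apply ModuleCat.hom_ext
    apply Submodule.linearMap_qext
    rfl

/-! ### `B`-torsion -/

/-- An element of `V_n` is `B`-torsion if it is in the kernel of some transition map. -/
def FIMod.IsBTorsion (V : FIMod k m) {a : FIProd m} (v : V.obj a) : Prop :=
  ∃ (b : FIProd m) (f : a ⟶ b), IsTransition f ∧ (V.map f).hom v = 0

theorem FIMod.map_eq_zero_of_card_le (V : FIMod k m) {a b c : FIProd m} {v : V.obj a}
    (f : a ⟶ b) (hv : (V.map f).hom v = 0) (g : a ⟶ c) (h : ∀ j, (b j).card ≤ (c j).card) :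
    (V.map g).hom v = 0 := by
  obtain ⟨t, rfl⟩ := FIProd.exists_factor f g h
  simp [hv]

/-- The maximal `B`-torsion submodule `V_T`, consisting of all `B`-torsion elements. -/
def FIMod.torsion [NeZero m] (V : FIMod k m) : FISub V where
  carrier a :=
    { carrier := {v | V.IsBTorsion v}
      zero_mem' := by
        obtain ⟨d, f, hf, -⟩ := FIProd.exists_large a a a
        exact ⟨d, f, hf, map_zero _⟩
      add_mem' := by
        rintro x y ⟨b, f, -, hx⟩ ⟨c, g, -, hy⟩
        obtain ⟨d, t, ht, hb, hc⟩ := FIProd.exists_large a b c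
        refine ⟨d, t, ht, ?_⟩
        rw [map_add, V.map_eq_zero_of_card_le f hx t hb, V.map_eq_zero_of_card_le g hy t hc,
          add_zero]
      smul_mem' := by
        rintro r x ⟨b, f, hf, hx⟩
        exact ⟨b, f, hf, by rw [map_smul, hx, smul_zero]⟩ }
  map_mem {a b} g v hv := by
    obtain ⟨c, f, -, hv⟩ := hv
    obtain ⟨d, t, ht, hc, -⟩ := FIProd.exists_large b c c
    refine ⟨d, t, ht, ?_⟩
    have := V.map_eq_zero_of_card_le f hv (g ≫ t) hc
    simpa using this

theorem FIMod.torsion_map [NeZero m] {V W : FIMod k m} (φ : V ⟶ W) (a : FIProd m) (v : V.obj a)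
    (hv : v ∈ (FIMod.torsion V).carrier a) :
    (φ.app a).hom v ∈ (FIMod.torsion W).carrier a := by
  obtain ⟨b, f, hf, hv⟩ := hv
  refine ⟨b, f, hf, ?_⟩
  have h := NatTrans.naturality_apply φ f v
  exact h.symm.trans ((congrArg (φ.app b).hom hv).trans (map_zero _))

/-- The `B`-torsion functor `V ↦ H^0_B(V) = V_T`. -/
def BTorsionFunctor (k : Type u) [CommRing k] (m : ℕ) [NeZero m] : FIMod k m ⥤ FIMod k m where
  obj V := (FIMod.torsion V).toMod
  map {V W} φ :=
    { app := fun a => ModuleCat.ofHom ((φ.app a).hom.restrict (FIMod.torsion_map φ a))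
      naturality := by
        intro a b f
        apply ModuleCat.hom_ext
        refine LinearMap.ext fun x => Subtype.ext ?_
        exact NatTrans.naturality_apply φ f x.1 }
  map_id V := rfl
  map_comp φ ψ := rfl

instance [NeZero m] : (BTorsionFunctor k m).Additive where
  map_add := rfl

/-! ### Enough projectives and injectives -/

instance : EnoughProjectives (FIMod k m) where
  presentation V := by
    let P : FIProd m → FIMod k m := fun a =>
      (evaluationLeftAdjoint (ModuleCat.{u} k) a).obj (Projective.over (V.obj a))
    have hP : ∀ a, Projective (P a) := fun a =>
      (evaluationAdjunctionRight (ModuleCat.{u} k) a).map_projective _ inferInstance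
    let q : ∀ a, P a ⟶ V := fun a =>
      ((evaluationAdjunctionRight (ModuleCat.{u} k) a).homEquiv _ V).symm (Projective.π (V.obj a))
    have hS : Projective (∐ P) :=
      ⟨fun {_ _} f e _ => ⟨Sigma.desc fun b => Projective.factorThru (Sigma.ι P b ≫ f) e, by
        refine Sigma.hom_ext _ _ fun b => ?_
        rw [Sigma.ι_desc_assoc, Projective.factorThru_comp]⟩⟩
    refine ⟨{ p := ∐ P, projective := hS, f := Sigma.desc q, epi := ?_ }⟩
    have : ∀ a, Epi ((Sigma.desc q).app a) := by
      intro a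
      have h1 : (Projective.π (V.obj a)) =
          (evaluationAdjunctionRight (ModuleCat.{u} k) a).unit.app _ ≫
            ((Sigma.ι P a).app a ≫ (Sigma.desc q).app a) := by
        rw [← NatTrans.comp_app, Sigma.ι_desc]
        have := ((evaluationAdjunctionRight (ModuleCat.{u} k) a).homEquiv _ V).apply_symm_apply
          (Projective.π (V.obj a))
        rw [Adjunction.homEquiv_unit] at this
        exact this.symm
      have h2 : Epi (((evaluationAdjunctionRight (ModuleCat.{u} k) a).unit.app _ ≫
            (Sigma.ι P a).app a) ≫ (Sigma.desc q).app a) := by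
        rw [Category.assoc, ← h1]
        infer_instance
      exact epi_of_epi ((evaluationAdjunctionRight (ModuleCat.{u} k) a).unit.app _ ≫
        (Sigma.ι P a).app a) ((Sigma.desc q).app a)
    exact NatTrans.epi_of_epi_app _

instance : EnoughInjectives (FIMod k m) where
  presentation V := by
    let J : FIProd m → FIMod k m := fun a =>
      (evaluationRightAdjoint (ModuleCat.{u} k) a).obj (Injective.under (V.obj a))
    have hJ : ∀ a, Injective (J a) := fun a =>
      Injective.injective_of_adjoint (evaluationAdjunctionLeft (ModuleCat.{u} k) a) _
    let q : ∀ a, V ⟶ J a := fun a =>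
      (evaluationAdjunctionLeft (ModuleCat.{u} k) a).homEquiv V _ (Injective.ι (V.obj a))
    refine ⟨{ J := ∏ᶜ J, injective := inferInstance, f := Pi.lift q, mono := ?_ }⟩
    have : ∀ a, Mono ((Pi.lift q).app a) := by
      intro a
      have h1 : (Injective.ι (V.obj a)) =
          (Pi.lift q).app a ≫ ((Pi.π J a).app a ≫
            (evaluationAdjunctionLeft (ModuleCat.{u} k) a).counit.app _) := by
        rw [← Category.assoc, ← NatTrans.comp_app, Pi.lift_π]
        have := ((evaluationAdjunctionLeft (ModuleCat.{u} k) a).homEquiv V _).symm_apply_apply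
          (Injective.ι (V.obj a))
        rw [Adjunction.homEquiv_counit] at this
        exact this.symm
      have h2 : Mono ((Pi.lift q).app a ≫ ((Pi.π J a).app a ≫
            (evaluationAdjunctionLeft (ModuleCat.{u} k) a).counit.app _)) := by
        rw [← h1]
        infer_instance
      exact mono_of_mono ((Pi.lift q).app a) ((Pi.π J a).app a ≫
        (evaluationAdjunctionLeft (ModuleCat.{u} k) a).counit.app _)
    exact NatTrans.mono_of_mono_app _

/-! ### Homology, local cohomology and the associated regions of `ℤ^m` -/

/-- The `FI^m`-homology functors `H_i`: the left derived functors of `H_0`. -/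
noncomputable def FIHomology (i : ℕ) (V : FIMod k m) : FIMod k m :=
  ((FIHomZero k m).leftDerived i).obj V

/-- The local cohomology functors `H^i_B`: the right derived functors of the `B`-torsion
functor. -/
noncomputable def FILocalCohomology [NeZero m] (i : ℕ) (V : FIMod k m) : FIMod k m :=
  ((BTorsionFunctor k m).rightDerived i).obj V

/-- `V_n = 0`, for `n ∈ ℤ^m`, with the convention `V_n = 0` for `n ∉ ℕ^m`. -/
def FIMod.VanishesAt (V : FIMod k m) (n : Fin m → ℤ) : Prop :=
  ∀ p : Fin m → ℕ, (∀ j, (p j : ℤ) = n j) → Subsingleton (V.obj (FIProd.ofVec p))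

/-- The region `⋃_j (r + e_j + ℕ^m)` of vectors at least one positive step from `r`. -/
def positiveStep {m : ℕ} (r : Fin m → ℤ) : Set (Fin m → ℤ) :=
  {n | ∃ (j : Fin m) (p : Fin m → ℕ), n = r + Pi.single j 1 + fun l => (p l : ℤ)}

/-- The `i`-th homological degree `HD_i(V) ⊆ ℤ^m`. -/
def HD (i : ℕ) (V : FIMod k m) : Set (Fin m → ℤ) :=
  {r | ∀ n ∈ positiveStep r, (FIHomology i V).VanishesAt n}

/-- The positive Castelnuovo–Mumford regularity `CMreg_+(V) ⊆ ℤ^m`. -/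
def CMregPos [NeZero m] (V : FIMod k m) : Set (Fin m → ℤ) :=
  {r | ∀ (i : ℕ) (a : Fin m → ℕ), ∑ j, a j = i →
    ∀ n ∈ positiveStep (r - fun l => (a l : ℤ)), (FILocalCohomology i V).VanishesAt n}

end Modules

/-!
Attach to an `FI^m`-module `V` and `n ∈ ℕ^m` the Koszul complex whose chains of degree `p` are the
families of elements of `V`, one in each subset of codimension `p` of `[n_1] × ⋯ × [n_m]`. Its
homology in degree `0` is `H_0(V)_n`. For a free module it is a direct sum of augmented chain
complexes of simplices, so it is exact in positive degrees, and chasing through the Koszul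
complexes of a projective resolution shows that exactness of the Koszul complex of `V` at degree
`i` forces `H_i(V)_n = 0`.

On the injective side, the Koszul complex of `I` is `Hom(K, I)` for a universal complex `K` of free
modules. In degree `c`, this `K` is the chain complex of a chessboard complex with rows indexed by
the elements of `n` and columns by those of `c`, and it is acyclic as soon as `c` is large. Its
cycles modulo boundaries therefore vanish in large degrees, and the Koszul complex of an injective
module is exact modulo torsion. Chasing through the Koszul complexes of an injective resolution, the
Koszul complex of `V` is exact at degree `i` once `H^q_B(V)` vanishes, for all `q`, on the subsets
of codimension `i + q`. Those have degrees `n - a - b` with `|a| = i` and `|b| = q`, which is where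
the hypothesis on `CMreg_+(V)` applies.
-/

/-! ### The chain complex of a simplex -/

section Chains

theorem map_mem_of_mem_supported {k α M : Type*} [CommRing k] [AddCommGroup M] [Module k M]
    {S : Set α} {N : Submodule k M} {φ : (α →₀ k) →ₗ[k] M}
    (h : ∀ σ ∈ S, φ (Finsupp.single σ 1) ∈ N) {z : α →₀ k} (hz : z ∈ Finsupp.supported k k S) :
    φ z ∈ N := by
  rw [Finsupp.supported_eq_span_single] at hz
  exact Submodule.span_le (p := N.comap φ).2 (Set.image_subset_iff.2 h) hz

theorem sum_sum_erase_eq_zero {W M : Type*} [DecidableEq W] [AddCommGroup M] {A : Finset W}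
    {f : W → W → M} (hf : ∀ s ∈ A, ∀ t ∈ A, s ≠ t → f s t = -f t s) :
    ∑ s ∈ A, ∑ t ∈ A.erase s, f s t = 0 := by
  rw [Finset.sum_sigma']
  refine Finset.sum_involution (fun p _ => ⟨p.2, p.1⟩) ?_ ?_ ?_ fun _ _ => rfl <;>
    rintro ⟨s, t⟩ hst <;> simp only [Finset.mem_sigma, Finset.mem_erase] at hst
  · rw [hf s hst.1 t hst.2.2 hst.2.1.symm, neg_add_cancel]
  · exact fun _ h => hst.2.1 (congrArg Sigma.fst h)
  · simpa only [Finset.mem_sigma, Finset.mem_erase] using ⟨hst.2.2, hst.2.1.symm, hst.1⟩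

variable {W O : Type*} [LinearOrder O]

/-- The sign with which `s` is removed from, or added to form, the finite set `B`. The order on the
vertices is pulled back along a rank function `e`, because the vertex types used here (products and
disjoint unions) do not carry a linear order. -/
def rankSign (e : W → O) (s : W) (B : Finset W) : ℤ := (-1) ^ (B.filter fun t => e t < e s).card

theorem rankSign_mul_self (e : W → O) (s : W) (B : Finset W) :
    rankSign e s B * rankSign e s B = 1 := by
  rw [rankSign, ← mul_pow, neg_one_mul, neg_neg, one_pow]

variable [DecidableEq W]

theorem rankSign_mul_rankSign_erase {e : W → O} (he : Function.Injective e) {s t : W}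
    {B : Finset W} (hs : s ∈ B) (ht : t ∈ B) (hst : s ≠ t) :
    rankSign e s B * rankSign e t (B.erase s) = -(rankSign e t B * rankSign e s (B.erase t)) := by
  wlog h : e s < e t generalizing s t
  · rw [this ht hs hst.symm ((he.ne hst).lt_or_gt.resolve_left h), neg_neg]
  have below_t : (B.erase s).filter (fun a => e a < e t) = (B.filter fun a => e a < e t).erase s :=
    Finset.filter_erase _ _ _
  have below_s : (B.erase t).filter (fun a => e a < e s) = B.filter fun a => e a < e s := by
    rw [Finset.filter_erase, Finset.erase_eq_of_notMem]
    exact fun ht => lt_asymm h (Finset.mem_filter.1 ht).2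
  have s_below_t : s ∈ B.filter fun a => e a < e t := Finset.mem_filter.2 ⟨hs, h⟩
  unfold rankSign
  rw [below_t, below_s, ← Finset.card_erase_add_one s_below_t]
  ring

theorem rankSign_mul_rankSign_insert_erase {e : W → O} (he : Function.Injective e) {s t : W}
    {A : Finset W} (hs : s ∉ A) (ht : t ∈ A) :
    rankSign e t A * rankSign e s (insert s (A.erase t)) =
      -(rankSign e s (insert s A) * rankSign e t (insert s A)) := by
  have hst : s ≠ t := fun h => hs (h ▸ ht)
  have key := rankSign_mul_rankSign_erase he (Finset.mem_insert_self s A)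
    (Finset.mem_insert_of_mem ht) hst
  rw [Finset.erase_insert hs, Finset.erase_insert_of_ne hst] at key
  have hsA := rankSign_mul_self e s (insert s A)
  have hsAt := rankSign_mul_self e s (insert s (A.erase t))
  linear_combination
    (rankSign e s (insert s A) * rankSign e s (insert s (A.erase t))) * key -
      (rankSign e t A * rankSign e s (insert s (A.erase t))) * hsA -
      (rankSign e s (insert s A) * rankSign e t (insert s A)) * hsAt

variable (k : Type*) [CommRing k]

/-- Contraction of the (augmented) chains of a simplex with a vertex. -/
noncomputable def contractVertex (e : W → O) (v : W) : (Finset W →₀ k) →ₗ[k] (Finset W →₀ k) :=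
  Finsupp.linearCombination k fun σ =>
    if v ∈ σ then rankSign e v σ • Finsupp.single (σ.erase v) (1 : k) else 0

/-- The cone with apex `v` over the chains of a simplex. -/
noncomputable def coneVertex (e : W → O) (v : W) : (Finset W →₀ k) →ₗ[k] (Finset W →₀ k) :=
  Finsupp.linearCombination k fun σ =>
    if v ∈ σ then 0 else rankSign e v (insert v σ) • Finsupp.single (insert v σ) (1 : k)

/-- The boundary map of the augmented chain complex of the simplex with vertex set `W`. Chains of
all degrees are collected in the free module on `Finset W`. -/
noncomputable def simplexBoundary [Fintype W] (e : W → O) :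
    (Finset W →₀ k) →ₗ[k] (Finset W →₀ k) :=
  ∑ v, contractVertex k e v

variable {k}

theorem contractVertex_single_of_mem {e : W → O} {v : W} {σ : Finset W} (h : v ∈ σ) :
    contractVertex k e v (Finsupp.single σ 1) =
      rankSign e v σ • Finsupp.single (σ.erase v) (1 : k) := by
  simp [contractVertex, h]

theorem contractVertex_single_of_notMem {e : W → O} {v : W} {σ : Finset W} (h : v ∉ σ) :
    contractVertex k e v (Finsupp.single σ 1) = 0 := by
  simp [contractVertex, h]

theorem coneVertex_single_of_mem {e : W → O} {v : W} {σ : Finset W} (h : v ∈ σ) :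
    coneVertex k e v (Finsupp.single σ 1) = 0 := by
  simp [coneVertex, h]

theorem coneVertex_single_of_notMem {e : W → O} {v : W} {σ : Finset W} (h : v ∉ σ) :
    coneVertex k e v (Finsupp.single σ 1) =
      rankSign e v (insert v σ) • Finsupp.single (insert v σ) (1 : k) := by
  simp [coneVertex, h]

theorem contractVertex_mem_supported {e : W → O} {v : W} {S T : Set (Finset W)}
    (h : ∀ σ ∈ S, v ∈ σ → σ.erase v ∈ T) {z : Finset W →₀ k} (hz : z ∈ Finsupp.supported k k S) :
    contractVertex k e v z ∈ Finsupp.supported k k T := by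
  refine map_mem_of_mem_supported (fun σ hσ => ?_) hz
  by_cases hv : v ∈ σ
  · rw [contractVertex_single_of_mem hv]
    exact zsmul_mem (Finsupp.single_mem_supported k _ (h σ hσ hv)) _
  · rw [contractVertex_single_of_notMem hv]
    exact zero_mem _

theorem coneVertex_mem_supported {e : W → O} {v : W} {S T : Set (Finset W)}
    (h : ∀ σ ∈ S, insert v σ ∈ T) {z : Finset W →₀ k} (hz : z ∈ Finsupp.supported k k S) :
    coneVertex k e v z ∈ Finsupp.supported k k T := by
  refine map_mem_of_mem_supported (fun σ hσ => ?_) hz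
  by_cases hv : v ∈ σ
  · rw [coneVertex_single_of_mem hv]
    exact zero_mem _
  · rw [coneVertex_single_of_notMem hv]
    exact zsmul_mem (Finsupp.single_mem_supported k _ (h σ hσ)) _

theorem cone_contract_single (e : W → O) (v : W) (σ : Finset W) :
    coneVertex k e v (contractVertex k e v (Finsupp.single σ 1)) =
      if v ∈ σ then Finsupp.single σ (1 : k) else 0 := by
  split_ifs with h
  · rw [contractVertex_single_of_mem h, map_zsmul,
      coneVertex_single_of_notMem (Finset.notMem_erase v σ),
      Finset.insert_erase h, smul_smul, rankSign_mul_self, one_smul]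
  · rw [contractVertex_single_of_notMem h, map_zero]

theorem contract_cone_single (e : W → O) (v : W) (σ : Finset W) :
    contractVertex k e v (coneVertex k e v (Finsupp.single σ 1)) =
      if v ∈ σ then 0 else Finsupp.single σ (1 : k) := by
  split_ifs with h
  · rw [coneVertex_single_of_mem h, map_zero]
  · rw [coneVertex_single_of_notMem h, map_zsmul,
      contractVertex_single_of_mem (Finset.mem_insert_self v σ),
      Finset.erase_insert h, smul_smul, rankSign_mul_self, one_smul]

theorem contract_cone_self (e : W → O) (v : W) (z : Finset W →₀ k) :
    contractVertex k e v (coneVertex k e v z) = z - coneVertex k e v (contractVertex k e v z) := by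
  suffices h : contractVertex k e v ∘ₗ coneVertex k e v =
    LinearMap.id - coneVertex k e v ∘ₗ contractVertex k e v from LinearMap.congr_fun h z
  refine Finsupp.basisSingleOne.ext fun σ => ?_
  simp only [Finsupp.coe_basisSingleOne, LinearMap.comp_apply, LinearMap.sub_apply,
    LinearMap.id_apply, cone_contract_single, contract_cone_single]
  split_ifs
  · rw [sub_self]
  · rw [sub_zero]

theorem contract_contract_self (e : W → O) (v : W) (z : Finset W →₀ k) :
    contractVertex k e v (contractVertex k e v z) = 0 := by
  suffices h : contractVertex k e v ∘ₗ contractVertex k e v = 0 from LinearMap.congr_fun h z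
  refine Finsupp.basisSingleOne.ext fun σ => ?_
  simp only [Finsupp.coe_basisSingleOne, LinearMap.comp_apply, LinearMap.zero_apply]
  by_cases h : v ∈ σ
  · rw [contractVertex_single_of_mem h, map_zsmul,
      contractVertex_single_of_notMem (Finset.notMem_erase v σ), smul_zero]
  · rw [contractVertex_single_of_notMem h, map_zero]

theorem contract_contract {e : W → O} (he : Function.Injective e) (v w : W) (z : Finset W →₀ k) :
    contractVertex k e v (contractVertex k e w z) =
      -contractVertex k e w (contractVertex k e v z) := by
  rcases eq_or_ne v w with rfl | hvw
  · rw [contract_contract_self, neg_zero]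
  suffices h : contractVertex k e v ∘ₗ contractVertex k e w =
      -(contractVertex k e w ∘ₗ contractVertex k e v) from LinearMap.congr_fun h z
  refine Finsupp.basisSingleOne.ext fun σ => ?_
  simp only [Finsupp.coe_basisSingleOne, LinearMap.comp_apply, LinearMap.neg_apply]
  by_cases hv : v ∈ σ <;> by_cases hw : w ∈ σ
  · rw [contractVertex_single_of_mem hv, contractVertex_single_of_mem hw, map_zsmul, map_zsmul,
      contractVertex_single_of_mem (Finset.mem_erase.2 ⟨hvw, hv⟩),
      contractVertex_single_of_mem (Finset.mem_erase.2 ⟨hvw.symm, hw⟩), smul_smul, smul_smul,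
      rankSign_mul_rankSign_erase he hw hv hvw.symm, neg_smul, Finset.erase_right_comm]
  · rw [contractVertex_single_of_mem hv, contractVertex_single_of_notMem hw, map_zsmul,
      contractVertex_single_of_notMem (mt Finset.mem_of_mem_erase hw), map_zero, smul_zero,
      neg_zero]
  · rw [contractVertex_single_of_mem hw, contractVertex_single_of_notMem hv, map_zsmul,
      contractVertex_single_of_notMem (mt Finset.mem_of_mem_erase hv), map_zero, smul_zero,
      neg_zero]
  · rw [contractVertex_single_of_notMem hv, contractVertex_single_of_notMem hw, map_zero,
      map_zero, neg_zero]

theorem contract_cone {e : W → O} (he : Function.Injective e) {v w : W} (hvw : v ≠ w)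
    (z : Finset W →₀ k) :
    contractVertex k e v (coneVertex k e w z) = -coneVertex k e w (contractVertex k e v z) := by
  suffices h : contractVertex k e v ∘ₗ coneVertex k e w =
      -(coneVertex k e w ∘ₗ contractVertex k e v) from LinearMap.congr_fun h z
  refine Finsupp.basisSingleOne.ext fun σ => ?_
  simp only [Finsupp.coe_basisSingleOne, LinearMap.comp_apply, LinearMap.neg_apply]
  by_cases hv : v ∈ σ <;> by_cases hw : w ∈ σ
  · rw [contractVertex_single_of_mem hv, coneVertex_single_of_mem hw, map_zsmul,
      coneVertex_single_of_mem (Finset.mem_erase.2 ⟨hvw.symm, hw⟩), map_zero, smul_zero, neg_zero]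
  · rw [contractVertex_single_of_mem hv, coneVertex_single_of_notMem hw, map_zsmul, map_zsmul,
      contractVertex_single_of_mem (Finset.mem_insert_of_mem hv),
      coneVertex_single_of_notMem (mt Finset.mem_of_mem_erase hw), smul_smul, smul_smul,
      rankSign_mul_rankSign_insert_erase he hw hv, neg_smul, neg_neg,
      Finset.erase_insert_of_ne hvw.symm]
  · rw [coneVertex_single_of_mem hw, contractVertex_single_of_notMem hv, map_zero, map_zero,
      neg_zero]
  · rw [contractVertex_single_of_notMem hv, coneVertex_single_of_notMem hw, map_zsmul,
      contractVertex_single_of_notMem (mt (Finset.mem_of_mem_insert_of_ne · hvw) hv), map_zero,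
      smul_zero, neg_zero]

variable [Fintype W]

theorem boundary_contract {e : W → O} (he : Function.Injective e) (v : W) (z : Finset W →₀ k) :
    simplexBoundary k e (contractVertex k e v z) =
      -contractVertex k e v (simplexBoundary k e z) := by
  simp only [simplexBoundary, LinearMap.sum_apply, map_sum, ← Finset.sum_neg_distrib,
    contract_contract he _ v]

theorem boundary_cone {e : W → O} (he : Function.Injective e) (v : W) (z : Finset W →₀ k) :
    simplexBoundary k e (coneVertex k e v z) = z - coneVertex k e v (simplexBoundary k e z) := by
  simp only [simplexBoundary, LinearMap.sum_apply, map_sum]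
  rw [← Finset.add_sum_erase _ _ (Finset.mem_univ v), ← Finset.add_sum_erase Finset.univ
    (fun w => coneVertex k e v (contractVertex k e w z)) (Finset.mem_univ v), contract_cone_self,
    Finset.sum_congr rfl fun w hw => contract_cone he (Finset.ne_of_mem_erase hw) z,
    Finset.sum_neg_distrib]
  abel

theorem boundary_boundary {e : W → O} (he : Function.Injective e) (z : Finset W →₀ k) :
    simplexBoundary k e (simplexBoundary k e z) = 0 := by
  simp only [simplexBoundary, LinearMap.sum_apply, map_sum]
  rw [← sum_sum_erase_eq_zero (A := Finset.univ)
    (f := fun w v => contractVertex k e v (contractVertex k e w z))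
    fun w _ v _ _ => contract_contract he v w z]
  exact Finset.sum_congr rfl fun w _ =>
    (Finset.sum_erase (a := w) _ (contract_contract_self e w z)).symm

end Chains

/-! ### Acyclicity of chessboard complexes -/

section Chessboard

variable {W O k : Type*} [DecidableEq W] [LinearOrder O] [CommRing k]

theorem sub_sum_cone_contract_mem_supported {e : W → O} {S : Set (Finset W)} {V : Finset W}
    (hV : ∀ σ ∈ S, ∀ v ∈ V, ∀ w ∈ V, v ∈ σ → w ∈ σ → v = w) {z : Finset W →₀ k}
    (hz : z ∈ Finsupp.supported k k S) :
    z - ∑ v ∈ V, coneVertex k e v (contractVertex k e v z) ∈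
      Finsupp.supported k k {σ ∈ S | Disjoint V σ} := by
  suffices h : (LinearMap.id - ∑ v ∈ V, coneVertex k e v ∘ₗ contractVertex k e v :
      (Finset W →₀ k) →ₗ[k] (Finset W →₀ k)) z ∈ Finsupp.supported k k {σ ∈ S | Disjoint V σ} by
    simpa only [LinearMap.sub_apply, LinearMap.id_apply, LinearMap.sum_apply,
      LinearMap.comp_apply] using h
  refine map_mem_of_mem_supported (fun σ hσ => ?_) hz
  simp only [LinearMap.sub_apply, LinearMap.id_apply, LinearMap.sum_apply, LinearMap.comp_apply,
    cone_contract_single]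
  by_cases h : Disjoint V σ
  · rw [Finset.sum_eq_zero fun v hv => if_neg (Finset.disjoint_left.1 h hv), sub_zero]
    exact Finsupp.single_mem_supported k _ ⟨hσ, h⟩
  · obtain ⟨v, hv, hvσ⟩ := Finset.not_disjoint_iff.1 h
    rw [Finset.sum_eq_single_of_mem v hv fun w hw hwv =>
      if_neg fun hwσ => hwv (hV σ hσ w hw v hv hwσ hvσ), if_pos hvσ, sub_self]
    exact zero_mem _

theorem exists_sub_boundary_mem_supported [Fintype W] {e : W → O} (he : Function.Injective e)
    {S D T : Set (Finset W)} {V : Finset W}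
    (hV : ∀ σ ∈ S, ∀ v ∈ V, ∀ w ∈ V, v ∈ σ → w ∈ σ → v = w)
    (hST : ∀ σ ∈ S, Disjoint V σ → σ ∈ T) {z : Finset W →₀ k} (hz : z ∈ Finsupp.supported k k S)
    (hlink : ∀ v ∈ V, ∃ w ∈ Finsupp.supported k k {σ ∈ T | insert v σ ∈ D},
      simplexBoundary k e w = contractVertex k e v z) :
    ∃ w ∈ Finsupp.supported k k D, z - simplexBoundary k e w ∈ Finsupp.supported k k T := by
  choose! w hw hwz using hlink
  refine ⟨-∑ v ∈ V, coneVertex k e v (w v),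
    neg_mem (sum_mem fun v hv => coneVertex_mem_supported (fun σ hσ => hσ.2) (hw v hv)), ?_⟩
  have moved : z - simplexBoundary k e (-∑ v ∈ V, coneVertex k e v (w v)) =
      (z - ∑ v ∈ V, coneVertex k e v (contractVertex k e v z)) + ∑ v ∈ V, w v := by
    rw [map_neg, map_sum, Finset.sum_congr rfl fun v _ => boundary_cone he v (w v),
      Finset.sum_sub_distrib, ← Finset.sum_congr rfl fun v hv =>
        congrArg (coneVertex k e v) (hwz v hv)]
    abel
  rw [moved]
  exact add_mem (Finsupp.supported_mono (fun σ hσ => hST σ hσ.1 hσ.2)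
    (sub_sum_cone_contract_mem_supported hV hz))
    (sum_mem fun v hv => Finsupp.supported_mono (fun σ hσ => hσ.1) (hw v hv))

variable {X Y : Type*}

/-- Placements of non-attacking rooks in the rows `R` and the columns `C`, on the fields allowed by
the relation `r`. They are the simplices of a chessboard complex. -/
def rookPlacements (r : X → Y → Prop) (R : Finset X) (C : Finset Y) : Set (Finset (X × Y)) :=
  {σ | (∀ v ∈ σ, v.1 ∈ R ∧ v.2 ∈ C ∧ r v.1 v.2) ∧
    ∀ v ∈ σ, ∀ w ∈ σ, (v.1 = w.1 ∨ v.2 = w.2) → v = w}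

/-- Acyclicity of the chessboard complex below the top degree: every cycle made of placements of
fewer than `R.card` rooks bounds. -/
def RookAcyclic (k : Type*) [CommRing k] [DecidableEq X] [DecidableEq Y] [Fintype X] [Fintype Y]
    (e : X × Y → O) (r : X → Y → Prop) (R : Finset X) (C : Finset Y) : Prop :=
  ∀ z ∈ Finsupp.supported k k {σ ∈ rookPlacements r R C | σ.card < R.card},
    simplexBoundary k e z = 0 →
    ∃ w ∈ Finsupp.supported k k (rookPlacements r R C), simplexBoundary k e w = z

variable {r : X → Y → Prop} {R R' : Finset X} {C C' : Finset Y}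

theorem card_le_of_mem_rookPlacements {σ : Finset (X × Y)} (h : σ ∈ rookPlacements r R C) :
    σ.card ≤ R.card :=
  Finset.card_le_card_of_injOn Prod.fst (fun v hv => (h.1 v hv).1)
    fun v hv w hw hvw => h.2 v hv w hw (Or.inl hvw)

theorem rookPlacements_mono (hR : R ⊆ R') (hC : C ⊆ C') :
    rookPlacements r R C ⊆ rookPlacements r R' C' :=
  fun _ h => ⟨fun v hv => ⟨hR (h.1 v hv).1, hC (h.1 v hv).2.1, (h.1 v hv).2.2⟩, h.2⟩

variable [DecidableEq X] [DecidableEq Y]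

theorem erase_mem_rookPlacements {σ : Finset (X × Y)} (h : σ ∈ rookPlacements r R C) {v : X × Y}
    (hv : v ∈ σ) : σ.erase v ∈ rookPlacements r (R.erase v.1) (C.erase v.2) := by
  refine ⟨fun w hw => ?_, fun w hw w' hw' =>
    h.2 w (Finset.mem_of_mem_erase hw) w' (Finset.mem_of_mem_erase hw')⟩
  obtain ⟨hne, hwσ⟩ := Finset.mem_erase.1 hw
  obtain ⟨hwR, hwC, hwr⟩ := h.1 w hwσ
  exact ⟨Finset.mem_erase.2 ⟨fun hrow => hne (h.2 w hwσ v hv (Or.inl hrow)), hwR⟩,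
    Finset.mem_erase.2 ⟨fun hcol => hne (h.2 w hwσ v hv (Or.inr hcol)), hwC⟩, hwr⟩

theorem insert_mem_rookPlacements {σ : Finset (X × Y)} {v : X × Y}
    (h : σ ∈ rookPlacements r (R.erase v.1) (C.erase v.2)) (hvR : v.1 ∈ R) (hvC : v.2 ∈ C)
    (hvr : r v.1 v.2) : insert v σ ∈ rookPlacements r R C := by
  have not_attacked : ∀ w ∈ σ, ¬(v.1 = w.1 ∨ v.2 = w.2) := by
    rintro w hw (hrow | hcol)
    · exact Finset.ne_of_mem_erase (h.1 w hw).1 hrow.symm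
    · exact Finset.ne_of_mem_erase (h.1 w hw).2.1 hcol.symm
  constructor
  · refine Finset.forall_mem_insert _ _ _ |>.2 ⟨⟨hvR, hvC, hvr⟩, ?_⟩
    exact (rookPlacements_mono (Finset.erase_subset _ _) (Finset.erase_subset _ _) h).1
  · intro w hw w' hw' hww'
    rcases Finset.mem_insert.1 hw with rfl | hwσ <;>
      rcases Finset.mem_insert.1 hw' with rfl | hwσ'
    · rfl
    · exact absurd hww' (not_attacked w' hwσ')
    · exact absurd (hww'.imp Eq.symm Eq.symm) (not_attacked w hwσ)
    · exact h.2 w hwσ w' hwσ' hww'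

variable [Fintype X] [Fintype Y] {e : X × Y → O}

theorem RookAcyclic.exists_boundary_eq_contract (he : Function.Injective e) {v : X × Y}
    (h : RookAcyclic k e r (R.erase v.1) (C.erase v.2)) {z : Finset (X × Y) →₀ k}
    (hz : z ∈ Finsupp.supported k k {σ ∈ rookPlacements r R C | σ.card < R.card})
    (hdz : simplexBoundary k e z = 0) :
    ∃ w ∈ Finsupp.supported k k (rookPlacements r (R.erase v.1) (C.erase v.2)),
      simplexBoundary k e w = contractVertex k e v z := by
  refine h _ (contractVertex_mem_supported (fun σ hσ hv => ?_) hz)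
    (by rw [boundary_contract he, hdz, map_zero, neg_zero])
  refine ⟨erase_mem_rookPlacements hσ.1 hv, ?_⟩
  rw [Finset.card_erase_of_mem hv, Finset.card_erase_of_mem (hσ.1.1 v hv).1]
  exact Nat.sub_lt_sub_right (Finset.card_pos.2 ⟨v, hv⟩) hσ.2

theorem exists_boundary_clearing_column (he : Function.Injective e) {y : Y} (hy : y ∈ C)
    (hlink : ∀ x ∈ R, r x y → RookAcyclic k e r (R.erase x) (C.erase y))
    {z : Finset (X × Y) →₀ k}
    (hz : z ∈ Finsupp.supported k k {σ ∈ rookPlacements r R C | σ.card < R.card})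
    (hdz : simplexBoundary k e z = 0) :
    ∃ w ∈ Finsupp.supported k k (rookPlacements r R C), z - simplexBoundary k e w ∈
      Finsupp.supported k k {σ ∈ rookPlacements r R (C.erase y) | σ.card < R.card} := by
  classical
  refine exists_sub_boundary_mem_supported he (V := R.filter (r · y) ×ˢ {y})
    (fun σ hσ v hv w hw hvσ hwσ => ?_) (fun σ hσ hdisj => ?_) hz ?_
  · exact hσ.1.2 v hvσ w hwσ (Or.inr ((Finset.mem_singleton.1 (Finset.mem_product.1 hv).2).trans
      (Finset.mem_singleton.1 (Finset.mem_product.1 hw).2).symm))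
  · refine ⟨⟨fun v hv => ?_, hσ.1.2⟩, hσ.2⟩
    obtain ⟨hvR, hvC, hvr⟩ := hσ.1.1 v hv
    refine ⟨hvR, Finset.mem_erase.2 ⟨fun hvy => Finset.disjoint_right.1 hdisj hv ?_, hvC⟩, hvr⟩
    exact Finset.mem_product.2 ⟨Finset.mem_filter.2 ⟨hvR, hvy ▸ hvr⟩, Finset.mem_singleton.2 hvy⟩
  · rintro ⟨x, y'⟩ hv
    simp only [Finset.mem_product, Finset.mem_filter, Finset.mem_singleton] at hv
    obtain ⟨⟨hx, hxy⟩, rfl⟩ := hv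
    obtain ⟨w, hw, hwz⟩ := (hlink x hx hxy).exists_boundary_eq_contract (v := (x, y')) he hz hdz
    refine ⟨w, Finsupp.supported_mono ?_ hw, hwz⟩
    refine fun σ hσ => ⟨⟨?_, ?_⟩, ?_⟩
    · exact rookPlacements_mono (Finset.erase_subset _ _) subset_rfl hσ
    · exact (card_le_of_mem_rookPlacements hσ).trans_lt (Finset.card_erase_lt_of_mem hx)
    · exact insert_mem_rookPlacements hσ hx hy hxy

theorem exists_boundary_clearing_row (he : Function.Injective e) {x : X} (hx : x ∈ R)
    (hlink : ∀ y ∈ C, r x y → RookAcyclic k e r (R.erase x) (C.erase y))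
    {z : Finset (X × Y) →₀ k}
    (hz : z ∈ Finsupp.supported k k {σ ∈ rookPlacements r R C | σ.card < R.card})
    (hdz : simplexBoundary k e z = 0) :
    ∃ w ∈ Finsupp.supported k k (rookPlacements r R C), z - simplexBoundary k e w ∈
      Finsupp.supported k k (rookPlacements r (R.erase x) C) := by
  classical
  refine exists_sub_boundary_mem_supported he (V := {x} ×ˢ C.filter (r x))
    (fun σ hσ v hv w hw hvσ hwσ => ?_) (fun σ hσ hdisj => ?_) hz ?_
  · exact hσ.1.2 v hvσ w hwσ (Or.inl ((Finset.mem_singleton.1 (Finset.mem_product.1 hv).1).trans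
      (Finset.mem_singleton.1 (Finset.mem_product.1 hw).1).symm))
  · refine ⟨fun v hv => ?_, hσ.1.2⟩
    obtain ⟨hvR, hvC, hvr⟩ := hσ.1.1 v hv
    refine ⟨Finset.mem_erase.2 ⟨fun hvx => Finset.disjoint_right.1 hdisj hv ?_, hvR⟩, hvC, hvr⟩
    exact Finset.mem_product.2 ⟨Finset.mem_singleton.2 hvx, Finset.mem_filter.2 ⟨hvC, hvx ▸ hvr⟩⟩
  · rintro ⟨x', y⟩ hv
    simp only [Finset.mem_product, Finset.mem_filter, Finset.mem_singleton] at hv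
    obtain ⟨rfl, hy, hxy⟩ := hv
    obtain ⟨w, hw, hwz⟩ := (hlink y hy hxy).exists_boundary_eq_contract (v := (x', y)) he hz hdz
    refine ⟨w, Finsupp.supported_mono ?_ hw, hwz⟩
    refine fun σ hσ => ⟨?_, ?_⟩
    · exact rookPlacements_mono subset_rfl (Finset.erase_subset _ _) hσ
    · exact insert_mem_rookPlacements hσ hx hy hxy

theorem exists_boundary_eq_of_mem_supported_link (he : Function.Injective e) {x : X} {y : Y}
    (hx : x ∈ R) (hy : y ∈ C) (hxy : r x y) {z : Finset (X × Y) →₀ k}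
    (hz : z ∈ Finsupp.supported k k (rookPlacements r (R.erase x) (C.erase y)))
    (hdz : simplexBoundary k e z = 0) :
    ∃ w ∈ Finsupp.supported k k (rookPlacements r R C), simplexBoundary k e w = z :=
  ⟨coneVertex k e (x, y) z,
    coneVertex_mem_supported
      (fun _ hσ => insert_mem_rookPlacements (v := (x, y)) hσ hx hy hxy) hz,
    by rw [boundary_cone he, hdz, map_zero, sub_zero]⟩

theorem rookAcyclic_of_link (he : Function.Injective e) {x : X} {y : Y} (hx : x ∈ R) (hy : y ∈ C)
    (hxy : r x y) (hcol : ∀ x' ∈ R, r x' y → RookAcyclic k e r (R.erase x') (C.erase y))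
    (hrow : ∀ y' ∈ C.erase y, r x y' →
      RookAcyclic k e r (R.erase x) ((C.erase y).erase y')) : RookAcyclic k e r R C := by
  intro z hz hdz
  -- Cleared of the column `y` and then of the row `x`, the cycle lies in the link of the field
  -- `(x, y)`, where the cone with this apex bounds it.
  obtain ⟨w₁, hw₁, hz₁⟩ := exists_boundary_clearing_column he hy hcol hz hdz
  have hdz₁ : simplexBoundary k e (z - simplexBoundary k e w₁) = 0 := by
    rw [map_sub, hdz, boundary_boundary he, sub_zero]
  obtain ⟨w₂, hw₂, hz₂⟩ := exists_boundary_clearing_row he hx hrow hz₁ hdz₁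
  have hdz₂ : simplexBoundary k e (z - simplexBoundary k e w₁ - simplexBoundary k e w₂) = 0 := by
    rw [map_sub, hdz₁, boundary_boundary he, sub_zero]
  obtain ⟨w₃, hw₃, hwz₃⟩ := exists_boundary_eq_of_mem_supported_link he hx hy hxy hz₂ hdz₂
  have hw₂' := Finsupp.supported_mono (R := k) (M := k)
    (rookPlacements_mono subset_rfl (Finset.erase_subset y C)) hw₂
  refine ⟨w₁ + w₂ + w₃, add_mem (add_mem hw₁ hw₂') hw₃, ?_⟩
  rw [map_add, map_add, hwz₃]
  abel

theorem rookAcyclic_of_card_eq_zero (hR : R.card = 0) : RookAcyclic k e r R C := by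
  intro z hz _
  have no_chains : {σ ∈ rookPlacements r R C | σ.card < R.card} = ∅ :=
    Set.eq_empty_of_forall_notMem fun σ hσ => by simp [hR] at hσ
  rw [no_chains, Finsupp.supported_empty, Submodule.mem_bot] at hz
  exact ⟨0, zero_mem _, by rw [hz, map_zero]⟩

theorem rookAcyclic_of_two_mul_card_le [∀ x, DecidablePred (r x)] (he : Function.Injective e)
    (h : ∀ x ∈ R, 2 * R.card ≤ (C.filter (r x)).card) : RookAcyclic k e r R C := by
  induction hN : R.card generalizing R C with
  | zero => exact rookAcyclic_of_card_eq_zero hN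
  | succ N ih =>
    obtain ⟨x, hx⟩ : R.Nonempty := Finset.card_pos.1 (by omega)
    obtain ⟨y, hy⟩ : (C.filter (r x)).Nonempty := Finset.card_pos.1 (by have := h x hx; omega)
    obtain ⟨hyC, hxy⟩ := Finset.mem_filter.1 hy
    have card_column_erase : ∀ (C : Finset Y) (y : Y) (x : X),
        (C.filter (r x)).card ≤ ((C.erase y).filter (r x)).card + 1 := fun C y x => by
      rw [Finset.filter_erase]
      exact Nat.sub_le_iff_le_add.1 Finset.pred_card_le_card_erase
    have card_row_erase : ∀ x' ∈ R, (R.erase x').card = N := fun x' hx' => by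
      rw [Finset.card_erase_of_mem hx', hN, Nat.add_sub_cancel]
    refine rookAcyclic_of_link he hx hyC hxy (fun x' hx' _ => ?_) (fun y' _ _ => ?_)
    · refine ih (fun x₁ hx₁ => ?_) (card_row_erase x' hx')
      have := h x₁ (Finset.mem_of_mem_erase hx₁)
      have := card_column_erase C y x₁
      rw [card_row_erase x' hx']
      omega
    · refine ih (fun x₁ hx₁ => ?_) (card_row_erase x hx)
      have := h x₁ (Finset.mem_of_mem_erase hx₁)
      have := card_column_erase C y x₁
      have := card_column_erase (C.erase y) y' x₁
      rw [card_row_erase x hx]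
      omega

end Chessboard

/-! ### Koszul complexes of `FI^m`-modules -/

section Subsets

variable {m : ℕ}

/-- The elements of the object `[n_1] × ⋯ × [n_m]` of `FI^m`. -/
abbrev Pts (n : Fin m → ℕ) : Type := Σ j, Fin (n j)

variable {n : Fin m → ℕ}

/-- The part of a set of elements of `[n_1] × ⋯ × [n_m]` that lies in `[n_j]`. -/
def ptsFiber (A : Finset (Pts n)) (j : Fin m) : Finset (Fin (n j)) :=
  Finset.univ.filter fun i => (⟨j, i⟩ : Pts n) ∈ A

theorem mem_ptsFiber {A : Finset (Pts n)} {j : Fin m} {i : Fin (n j)} :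
    i ∈ ptsFiber A j ↔ (⟨j, i⟩ : Pts n) ∈ A := by
  simp [ptsFiber]

theorem ptsFiber_mono {A B : Finset (Pts n)} (h : A ⊆ B) (j : Fin m) :
    ptsFiber A j ⊆ ptsFiber B j :=
  fun _ hi => mem_ptsFiber.2 (h (mem_ptsFiber.1 hi))

/-- The object of `FI^m` given by a set of elements of `[n_1] × ⋯ × [n_m]`, which sends `A ⊆ B` to
the inclusion. -/
noncomputable def subsetFunctor (n : Fin m → ℕ) : Finset (Pts n) ⥤ FIProd m where
  obj A := FIProd.ofVec fun j => (ptsFiber A j).card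
  map {A B} h := fun j =>
    ((ptsFiber A j).equivFin.symm.toEmbedding.trans
      (Subtype.impEmbedding _ _ fun i hi => ptsFiber_mono (leOfHom h) j hi)).trans
      (ptsFiber B j).equivFin.toEmbedding
  map_id A := by
    funext j
    refine Function.Embedding.ext fun i => ?_
    change (ptsFiber A j).equivFin ((ptsFiber A j).equivFin.symm i) = i
    simp
  map_comp {A B C} f g := by
    funext j
    refine Function.Embedding.ext fun i => ?_
    change (ptsFiber C j).equivFin _ = (ptsFiber C j).equivFin _
    refine congrArg _ (Subtype.ext ?_)
    change _ = (((ptsFiber B j).equivFin.symm ((ptsFiber B j).equivFin _)) : Fin (n j))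
    rw [Equiv.symm_apply_apply]
    rfl

/-- The element of `[n_j]` numbered by `i`. -/
noncomputable def ptsElt (A : Finset (Pts n)) (j : Fin m)
    (i : Fin ((subsetFunctor n).obj A j).card) : Fin (n j) :=
  ((ptsFiber A j).equivFin.symm i).1

theorem ptsElt_injective (A : Finset (Pts n)) (j : Fin m) : Function.Injective (ptsElt A j) :=
  Subtype.val_injective.comp (Equiv.injective _)

theorem ptsElt_mem (A : Finset (Pts n)) (j : Fin m) (i) : (⟨j, ptsElt A j i⟩ : Pts n) ∈ A :=
  mem_ptsFiber.1 ((ptsFiber A j).equivFin.symm i).2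

theorem exists_ptsElt {A : Finset (Pts n)} {j : Fin m} {i : Fin (n j)}
    (h : (⟨j, i⟩ : Pts n) ∈ A) : ∃ i', ptsElt A j i' = i :=
  ⟨(ptsFiber A j).equivFin ⟨i, mem_ptsFiber.2 h⟩, by
    unfold ptsElt
    rw [Equiv.symm_apply_apply]⟩

theorem ptsElt_map {A B : Finset (Pts n)} (h : A ⟶ B) (j : Fin m) (i) :
    ptsElt B j (FI.toEmb ((subsetFunctor n).map h j) i) = ptsElt A j i := by
  change ((ptsFiber B j).equivFin.symm ((ptsFiber B j).equivFin _)).1 = _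
  rw [Equiv.symm_apply_apply]
  rfl

theorem subsetFunctor_hom_ext {a : FIProd m} {A : Finset (Pts n)}
    {f g : a ⟶ (subsetFunctor n).obj A}
    (h : ∀ j i, ptsElt A j (FI.toEmb (f j) i) = ptsElt A j (FI.toEmb (g j) i)) : f = g := by
  funext j
  exact Function.Embedding.ext fun i => ptsElt_injective A j (h j i)

theorem subsetFunctor_map_injective {a : FIProd m} {A B : Finset (Pts n)} (h : A ⟶ B)
    {f g : a ⟶ (subsetFunctor n).obj A}
    (hfg : f ≫ (subsetFunctor n).map h = g ≫ (subsetFunctor n).map h) : f = g := by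
  refine subsetFunctor_hom_ext fun j i => ?_
  rw [← ptsElt_map h, ← ptsElt_map h]
  exact congrArg (fun t : a ⟶ (subsetFunctor n).obj B => ptsElt B j (FI.toEmb (t j) i)) hfg

/-- The set of elements of `[n_1] × ⋯ × [n_m]` hit by a morphism to (the object given by) `A`. -/
noncomputable def ptsImage {a : FIProd m} {A : Finset (Pts n)} (f : a ⟶ (subsetFunctor n).obj A) :
    Finset (Pts n) :=
  Finset.univ.image fun p : Σ j, Fin (a j).card => ⟨p.1, ptsElt A p.1 (FI.toEmb (f p.1) p.2)⟩

theorem ptsElt_mem_ptsImage {a : FIProd m} {A : Finset (Pts n)} (f : a ⟶ (subsetFunctor n).obj A)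
    (j : Fin m) (i : Fin (a j).card) :
    (⟨j, ptsElt A j (FI.toEmb (f j) i)⟩ : Pts n) ∈ ptsImage f :=
  Finset.mem_image.2 ⟨⟨j, i⟩, Finset.mem_univ _, rfl⟩

theorem ptsImage_subset {a : FIProd m} {A : Finset (Pts n)} (f : a ⟶ (subsetFunctor n).obj A) :
    ptsImage f ⊆ A :=
  Finset.image_subset_iff.2 fun p _ => ptsElt_mem A p.1 _

theorem ptsImage_comp_map {a : FIProd m} {A B : Finset (Pts n)}
    (f : a ⟶ (subsetFunctor n).obj A) (h : A ⟶ B) :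
    ptsImage (f ≫ (subsetFunctor n).map h) = ptsImage f :=
  Finset.image_congr fun p _ => Sigma.ext rfl (heq_of_eq (ptsElt_map h p.1 _))

theorem exists_comp_map_eq {a : FIProd m} {A B : Finset (Pts n)} (h : A ⟶ B)
    (f : a ⟶ (subsetFunctor n).obj B) (hf : ptsImage f ⊆ A) :
    ∃ t : a ⟶ (subsetFunctor n).obj A, t ≫ (subsetFunctor n).map h = f := by
  choose t ht using fun j i => exists_ptsElt (hf (ptsElt_mem_ptsImage f j i))
  have t_injective : ∀ j, Function.Injective (t j) := fun j i i' hii' =>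
    (FI.toEmb (f j)).injective (ptsElt_injective B j (by rw [← ht, ← ht, hii']))
  refine ⟨fun j => (⟨t j, t_injective j⟩ : Fin (a j).card ↪ _),
    subsetFunctor_hom_ext fun j i => ?_⟩
  rw [← ht]
  exact ptsElt_map h j (t j i)

theorem isTransition_map_erase {A : Finset (Pts n)} {s : Pts n} (hs : s ∈ A)
    (h : A.erase s ⟶ A) : IsTransition ((subsetFunctor n).map h) := by
  refine ⟨s.1, fun hbij => ?_⟩
  obtain ⟨i, hi⟩ := exists_ptsElt (A := A) (j := s.1) (i := s.2) hs
  obtain ⟨i', rfl⟩ := hbij.2 i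
  rw [ptsElt_map] at hi
  have hmem := ptsElt_mem (A.erase s) s.1 i'
  rw [hi] at hmem
  exact Finset.notMem_erase s A hmem

theorem exists_notMem_ptsImage {a : FIProd m} {A : Finset (Pts n)}
    {f : a ⟶ (subsetFunctor n).obj A} (hf : IsTransition f) : ∃ s ∈ A, s ∉ ptsImage f := by
  obtain ⟨j, hj⟩ := hf
  have not_surjective : ¬Function.Surjective (FI.toEmb (f j)) :=
    fun h => hj ⟨(FI.toEmb (f j)).injective, h⟩
  obtain ⟨i, hi⟩ := not_forall.1 not_surjective
  refine ⟨⟨j, ptsElt A j i⟩, ptsElt_mem A j i, fun hmem => hi ?_⟩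
  obtain ⟨⟨j', i'⟩, -, h⟩ := Finset.mem_image.1 hmem
  obtain rfl : j' = j := congrArg Sigma.fst h
  exact ⟨i', ptsElt_injective A j' (eq_of_heq (Sigma.mk.inj h).2)⟩

theorem exists_factor_erase {a : FIProd m} {A : Finset (Pts n)} (f : a ⟶ (subsetFunctor n).obj A)
    (hf : IsTransition f) : ∃ s ∈ A, ∃ t : a ⟶ (subsetFunctor n).obj (A.erase s),
      t ≫ (subsetFunctor n).map (homOfLE (Finset.erase_subset s A)) = f := by
  obtain ⟨s, hs, hsf⟩ := exists_notMem_ptsImage hf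
  exact ⟨s, hs, exists_comp_map_eq _ f (Finset.subset_erase.2 ⟨ptsImage_subset f, hsf⟩)⟩

theorem subsetFunctor_obj_univ (n : Fin m → ℕ) :
    (subsetFunctor n).obj Finset.univ = FIProd.ofVec n := by
  funext j
  change FI.mk (ptsFiber Finset.univ j).card = FI.mk (n j)
  simp [ptsFiber]

/-- An injective rank function on the elements, used to define signs. -/
noncomputable def ptsRank (s : Pts n) : ℕ := (Fintype.equivFin (Pts n) s : ℕ)

theorem ptsRank_injective : Function.Injective (ptsRank (n := n)) :=
  Fin.val_injective.comp (Equiv.injective _)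

end Subsets

section Koszul

variable {k : Type u} [CommRing k] {m : ℕ} {n : Fin m → ℕ} {V W : FIMod k m}

/-- The Koszul complex of `V` in degree `n`: families of elements of `V`, indexed by the sets of
elements of `[n_1] × ⋯ × [n_m]`. All homological degrees are collected in one module; see
`Koszul.homogeneous` for the grading. -/
abbrev Koszul (V : FIMod k m) (n : Fin m → ℕ) : Type u :=
  ∀ A : Finset (Pts n), V.obj ((subsetFunctor n).obj A)

/-- The Koszul chains of degree `p`: the families supported on the sets of codimension `p`. -/
noncomputable def Koszul.homogeneous (V : FIMod k m) (n : Fin m → ℕ) (p : ℕ) :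
    Submodule k (Koszul V n) where
  carrier := {x | ∀ A : Finset (Pts n), A.card + p ≠ Fintype.card (Pts n) → x A = 0}
  zero_mem' _ _ := rfl
  add_mem' hx hy A hA := by rw [Pi.add_apply, hx A hA, hy A hA, add_zero]
  smul_mem' r x hx A hA := by rw [Pi.smul_apply, hx A hA, smul_zero]

/-- The Koszul chains all of whose components are `B`-torsion. -/
noncomputable def Koszul.torsion [NeZero m] (V : FIMod k m) (n : Fin m → ℕ) :
    Submodule k (Koszul V n) :=
  Submodule.pi Set.univ fun A => V.torsion.carrier ((subsetFunctor n).obj A)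

/-- The map on `V` given by the inclusion of a set of elements into a larger one. -/
noncomputable def inclMap (V : FIMod k m) {A B : Finset (Pts n)} (h : A ⊆ B) :
    V.obj ((subsetFunctor n).obj A) →ₗ[k] V.obj ((subsetFunctor n).obj B) :=
  (V.map ((subsetFunctor n).map (homOfLE h))).hom

theorem inclMap_inclMap {A B C : Finset (Pts n)} (h : A ⊆ B) (h' : B ⊆ C)
    (v : V.obj ((subsetFunctor n).obj A)) :
    inclMap V h' (inclMap V h v) = inclMap V (h.trans h') v := by
  unfold inclMap
  rw [← LinearMap.comp_apply, ← ModuleCat.hom_comp, ← V.map_comp, ← Functor.map_comp]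
  rfl

theorem inclMap_congr (x : Koszul V n) {A B C : Finset (Pts n)} (hBC : B = C) (hB : B ⊆ A)
    (hC : C ⊆ A) : inclMap V hB (x B) = inclMap V hC (x C) := by
  subst hBC
  rfl

theorem app_inclMap (φ : V ⟶ W) {A B : Finset (Pts n)} (h : A ⊆ B)
    (v : V.obj ((subsetFunctor n).obj A)) :
    (φ.app _).hom (inclMap V h v) = inclMap W h ((φ.app _).hom v) :=
  NatTrans.naturality_apply φ _ v

/-- The Koszul differential. -/
noncomputable def Koszul.d : Koszul V n →ₗ[k] Koszul V n where
  toFun x A := ∑ s ∈ A, rankSign ptsRank s A • inclMap V (Finset.erase_subset s A) (x (A.erase s))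
  map_add' x y := by
    funext A
    simp [Finset.sum_add_distrib]
  map_smul' r x := by
    funext A
    simp [Finset.smul_sum, smul_comm r]

theorem Koszul.d_apply (x : Koszul V n) (A : Finset (Pts n)) : Koszul.d x A =
    ∑ s ∈ A, rankSign ptsRank s A • inclMap V (Finset.erase_subset s A) (x (A.erase s)) := rfl

/-- The map of Koszul complexes induced by a map of modules. -/
noncomputable def Koszul.map (φ : V ⟶ W) : Koszul V n →ₗ[k] Koszul W n where
  toFun x A := (φ.app _).hom (x A)
  map_add' x y := by
    funext A
    simp
  map_smul' r x := by
    funext A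
    simp

theorem Koszul.map_apply (φ : V ⟶ W) (x : Koszul V n) (A : Finset (Pts n)) :
    Koszul.map φ x A = (φ.app _).hom (x A) := rfl

theorem Koszul.map_d (φ : V ⟶ W) (x : Koszul V n) :
    Koszul.map φ (Koszul.d x) = Koszul.d (Koszul.map φ x) := by
  funext A
  rw [Koszul.map_apply, Koszul.d_apply, Koszul.d_apply, map_sum]
  refine Finset.sum_congr rfl fun s _ => ?_
  rw [map_zsmul, app_inclMap, Koszul.map_apply]

theorem Koszul.d_d (x : Koszul V n) : Koszul.d (Koszul.d x) = 0 := by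
  funext A
  rw [Koszul.d_apply, Pi.zero_apply, ← sum_sum_erase_eq_zero (A := A) (f := fun s t =>
    (rankSign ptsRank s A * rankSign ptsRank t (A.erase s)) •
      inclMap V (((A.erase s).erase_subset t).trans (A.erase_subset s)) (x ((A.erase s).erase t)))]
  · refine Finset.sum_congr rfl fun s _ => ?_
    rw [Koszul.d_apply, map_sum, Finset.smul_sum]
    refine Finset.sum_congr rfl fun t _ => ?_
    rw [map_zsmul, inclMap_inclMap, smul_smul]
  · intro s hs t ht hst
    rw [rankSign_mul_rankSign_erase ptsRank_injective hs ht hst, neg_smul,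
      inclMap_congr x Finset.erase_right_comm]

theorem Koszul.d_mem_homogeneous {p : ℕ} {x : Koszul V n}
    (hx : x ∈ Koszul.homogeneous V n (p + 1)) : Koszul.d x ∈ Koszul.homogeneous V n p := by
  intro A hA
  rw [Koszul.d_apply]
  refine Finset.sum_eq_zero fun s hs => ?_
  have := Finset.card_erase_add_one hs
  rw [hx _ (by omega), map_zero, smul_zero]

theorem Koszul.map_mem_homogeneous {p : ℕ} {x : Koszul V n} (hx : x ∈ Koszul.homogeneous V n p)
    (φ : V ⟶ W) : Koszul.map φ x ∈ Koszul.homogeneous W n p := by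
  intro A hA
  rw [Koszul.map_apply, hx A hA, map_zero]

theorem Koszul.exists_mem_homogeneous {p : ℕ} {P : ∀ A : Finset (Pts n),
    V.obj ((subsetFunctor n).obj A) → Prop}
    (h0 : ∀ A : Finset (Pts n), A.card + p ≠ Fintype.card (Pts n) → P A 0)
    (h : ∀ A : Finset (Pts n), A.card + p = Fintype.card (Pts n) → ∃ v, P A v) :
    ∃ x ∈ Koszul.homogeneous V n p, ∀ A, P A (x A) := by
  have exists_component : ∀ A : Finset (Pts n), ∃ v : V.obj ((subsetFunctor n).obj A),
      (A.card + p ≠ Fintype.card (Pts n) → v = 0) ∧ P A v := by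
    intro A
    by_cases hA : A.card + p = Fintype.card (Pts n)
    · obtain ⟨v, hv⟩ := h A hA
      exact ⟨v, fun h => absurd hA h, hv⟩
    · exact ⟨0, fun _ => rfl, h0 A hA⟩
  choose x hx hP using exists_component
  exact ⟨x, hx, hP⟩

/-- Exactness of the Koszul complex of `V` in degree `n` at the chains of degree `p`. -/
def KoszulExactAt (V : FIMod k m) (n : Fin m → ℕ) (p : ℕ) : Prop :=
  ∀ x ∈ Koszul.homogeneous V n p, Koszul.d x = 0 →
    ∃ y ∈ Koszul.homogeneous V n (p + 1), Koszul.d y = x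

/-- Exactness of the Koszul complex of `V` modulo `B`-torsion chains. -/
def KoszulExactModTorsionAt [NeZero m] (V : FIMod k m) (n : Fin m → ℕ) (p : ℕ) : Prop :=
  ∀ x ∈ Koszul.homogeneous V n p, Koszul.d x ∈ Koszul.torsion V n →
    ∃ y ∈ Koszul.homogeneous V n (p + 1), x - Koszul.d y ∈ Koszul.torsion V n

end Koszul

/-! ### Free and projective modules -/

section Cube

variable {W O M : Type*} [DecidableEq W] [LinearOrder O] [AddCommGroup M]

/-- The contraction in the direction `s` of a family indexed by the vertices of a cube. -/
def cubeContraction (e : W → O) (s : W) (g : Finset W → M) (A : Finset W) : M :=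
  if s ∈ A then 0 else rankSign e s (insert s A) • g (insert s A)

theorem sum_cubeContraction_eq {e : W → O} (he : Function.Injective e) {g : Finset W → M}
    (hg : ∀ A, ∑ t ∈ A, rankSign e t A • g (A.erase t) = 0) (s : W) (A : Finset W) :
    ∑ t ∈ A, rankSign e t A • cubeContraction e s g (A.erase t) = g A := by
  by_cases hs : s ∈ A
  · rw [Finset.sum_eq_single_of_mem s hs, cubeContraction, if_neg (Finset.notMem_erase s A),
      Finset.insert_erase hs, smul_smul, rankSign_mul_self, one_smul]
    intro t _ hts
    rw [cubeContraction, if_pos (Finset.mem_erase.2 ⟨hts.symm, hs⟩), smul_zero]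
  · have cycle_insert := hg (insert s A)
    rw [Finset.sum_insert hs, Finset.erase_insert hs] at cycle_insert
    have sum_eq : ∑ t ∈ A, rankSign e t A • cubeContraction e s g (A.erase t) =
        -(rankSign e s (insert s A) •
          ∑ t ∈ A, rankSign e t (insert s A) • g ((insert s A).erase t)) := by
      rw [Finset.smul_sum, ← Finset.sum_neg_distrib]
      refine Finset.sum_congr rfl fun t ht => ?_
      rw [cubeContraction, if_neg fun h => hs (Finset.mem_of_mem_erase h), smul_smul, smul_smul,
        rankSign_mul_rankSign_insert_erase he hs ht, neg_smul,
        Finset.erase_insert_of_ne fun h : s = t => hs (h ▸ ht)]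
    rw [sum_eq, eq_neg_of_add_eq_zero_right cycle_insert, smul_neg, neg_neg, smul_smul,
      rankSign_mul_self, one_smul]

variable [Fintype W] {k E : Type*} [CommRing k]

theorem exists_cubeContraction_of_support_subset {e : W → O} (he : Function.Injective e)
    {supp : E → Finset W} {g : Finset W → E →₀ k} (hsupp : ∀ A x, g A x ≠ 0 → supp x ⊆ A)
    (huniv : g Finset.univ = 0)
    (hg : ∀ A, ∑ t ∈ A, rankSign e t A • g (A.erase t) = 0) :
    ∃ h : Finset W → E →₀ k, (∀ A x, h A x ≠ 0 → supp x ⊆ A) ∧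
      (∀ A, (∀ s ∉ A, g (insert s A) = 0) → h A = 0) ∧
      ∀ A, ∑ t ∈ A, rankSign e t A • h (A.erase t) = g A := by
  classical
  cases isEmpty_or_nonempty W
  · exact ⟨0, fun _ _ h => absurd rfl h, fun _ _ => rfl, fun A => by
      rw [Subsingleton.elim A Finset.univ, huniv]
      simp⟩
  have exists_direction : ∀ x, ∃ s, supp x ≠ Finset.univ → s ∉ supp x := fun x => by
    by_contra! h
    exact (h (Classical.arbitrary W)).1 (Finset.eq_univ_iff_forall.2 fun s => (h s).2)
  -- The equations hold for each `x : E` separately, so each may use a direction of its own.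
  choose c hc using exists_direction
  let contr : Finset W → E → k := fun A x => cubeContraction e (c x) (fun B => g B x) A
  have contr_ne_zero : ∀ {A x}, contr A x ≠ 0 → c x ∉ A ∧ g (insert (c x) A) x ≠ 0 := by
    intro A x h
    by_cases hA : c x ∈ A
    · exact absurd (if_pos hA) h
    · exact ⟨hA, fun h0 => h ((if_neg hA).trans (by simp only [h0, smul_zero]))⟩
  let h : Finset W → E →₀ k := fun A =>
    Finsupp.onFinset (Finset.univ.biUnion fun s => (g (insert s A)).support) (contr A) fun x hx =>
      Finset.mem_biUnion.2 ⟨c x, Finset.mem_univ _, Finsupp.mem_support_iff.2 (contr_ne_zero hx).2⟩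
  refine ⟨h, fun A x hx => ?_, fun A hA => Finsupp.ext fun x => ?_,
    fun A => Finsupp.ext fun x => ?_⟩
  · have hgx := (contr_ne_zero hx).2
    have supp_ne_univ : supp x ≠ Finset.univ := fun h => hgx <| by
      have insert_eq_univ := Finset.univ_subset_iff.1 (h.symm.subset.trans (hsupp _ x hgx))
      rw [insert_eq_univ, huniv, Finsupp.zero_apply]
    exact (Finset.subset_insert_iff_of_notMem (hc x supp_ne_univ)).1 (hsupp _ x hgx)
  · by_contra hx
    obtain ⟨hcA, hgx⟩ := contr_ne_zero hx
    exact hgx (by rw [hA _ hcA, Finsupp.zero_apply])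
  · rw [Finsupp.finsetSum_apply]
    refine sum_cubeContraction_eq he (g := fun B => g B x) (fun B => ?_) (c x) A
    simpa only [Finsupp.finsetSum_apply, Finsupp.smul_apply, Finsupp.zero_apply] using
      DFunLike.congr_fun (hg B) x

end Cube

section Free

variable {k : Type u} [CommRing k] {m : ℕ} {n : Fin m → ℕ}

/-- Composition with `g` on the basis of a free module. -/
def freePush {ι : Type u} (o : ι → FIProd m) {b c : FIProd m} (g : b ⟶ c) (p : Σ i, (o i ⟶ b)) :
    Σ i, (o i ⟶ c) :=
  ⟨p.1, p.2 ≫ g⟩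

/-- The free module with generators in the degrees `o i`. -/
noncomputable def freeMod (k : Type u) [CommRing k] {ι : Type u} (o : ι → FIProd m) :
    FIMod k m where
  obj b := ModuleCat.of k ((Σ i, (o i ⟶ b)) →₀ k)
  map g := ModuleCat.ofHom (Finsupp.lmapDomain k k (freePush o g))
  map_id b := by
    refine ModuleCat.hom_ext (Finsupp.lhom_ext' fun p => LinearMap.ext_ring ?_)
    simp [freePush]
  map_comp g h := by
    refine ModuleCat.hom_ext (Finsupp.lhom_ext' fun p => LinearMap.ext_ring ?_)
    simp [freePush]

variable {ι : Type u} {o : ι → FIProd m} {V : FIMod k m}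

/-- The coefficients of an element of a free module. -/
noncomputable def freeMod.coeffs (k : Type u) [CommRing k] (o : ι → FIProd m) (b : FIProd m) :
    (freeMod k o).obj b ≃ₗ[k] ((Σ i, (o i ⟶ b)) →₀ k) :=
  LinearEquiv.refl k _

/-- The basis element of a free module given by a generator and a morphism. -/
noncomputable def freeMod.basis (k : Type u) [CommRing k] {o : ι → FIProd m} {b : FIProd m}
    (i : ι) (f : o i ⟶ b) : (freeMod k o).obj b :=
  (freeMod.coeffs k o b).symm (Finsupp.single ⟨i, f⟩ 1)

theorem freeMod.coeffs_map {b c : FIProd m} (g : b ⟶ c) (v : (freeMod k o).obj b) :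
    freeMod.coeffs k o c (((freeMod k o).map g).hom v) =
      (freeMod.coeffs k o b v).mapDomain (freePush o g) :=
  rfl

theorem freeMod.map_basis {b c : FIProd m} (g : b ⟶ c) (i : ι) (f : o i ⟶ b) :
    ((freeMod k o).map g).hom (freeMod.basis k i f) = freeMod.basis k i (f ≫ g) :=
  Finsupp.mapDomain_single

theorem freeMod.linearMap_ext {M : Type*} [AddCommGroup M] [Module k M] {b : FIProd m}
    {φ ψ : (freeMod k o).obj b →ₗ[k] M}
    (h : ∀ i f, φ (freeMod.basis k i f) = ψ (freeMod.basis k i f)) : φ = ψ :=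
  Finsupp.lhom_ext' fun p => LinearMap.ext_ring (h p.1 p.2)

theorem freeMod.mem_of_basis_mem {b : FIProd m} {N : Submodule k ((freeMod k o).obj b)}
    {w : (freeMod k o).obj b}
    (h : ∀ i f, freeMod.coeffs k o b w ⟨i, f⟩ ≠ 0 → freeMod.basis k i f ∈ N) : w ∈ N := by
  rw [← (freeMod.coeffs k o b).symm_apply_apply w, ← Finsupp.sum_single (freeMod.coeffs k o b w),
    Finsupp.sum, map_sum]
  refine sum_mem fun p hp => ?_
  rw [← mul_one (freeMod.coeffs k o b w p), ← smul_eq_mul, ← Finsupp.smul_single, map_smul]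
  exact N.smul_mem _ (h p.1 p.2 (Finsupp.mem_support_iff.1 hp))

/-- The linear extension to a free module of a map on its basis. -/
noncomputable def freeMod.lift {M : Type*} [AddCommGroup M] [Module k M] {b : FIProd m}
    (φ : ∀ i, (o i ⟶ b) → M) : (freeMod k o).obj b →ₗ[k] M :=
  Finsupp.linearCombination k (fun p : Σ i, (o i ⟶ b) => φ p.1 p.2) ∘ₗ
    (freeMod.coeffs k o b).toLinearMap

theorem freeMod.lift_basis {M : Type*} [AddCommGroup M] [Module k M] {b : FIProd m}
    (φ : ∀ i, (o i ⟶ b) → M) (i : ι) (f : o i ⟶ b) :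
    freeMod.lift (k := k) φ (freeMod.basis k i f) = φ i f :=
  (Finsupp.linearCombination_single k 1 _).trans (one_smul k _)

/-- The map from a free module given by the images of the generators. -/
noncomputable def freeMod.desc (v : ∀ i, V.obj (o i)) : freeMod k o ⟶ V where
  app b := ModuleCat.ofHom (freeMod.lift fun i f => (V.map f).hom (v i))
  naturality b c g := by
    refine ModuleCat.hom_ext (freeMod.linearMap_ext fun i f => ?_)
    change freeMod.lift (fun i f => (V.map f).hom (v i))
        (((freeMod k o).map g).hom (freeMod.basis k i f)) =
      (V.map g).hom (freeMod.lift (fun i f => (V.map f).hom (v i)) (freeMod.basis k i f))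
    rw [freeMod.map_basis, freeMod.lift_basis, freeMod.lift_basis]
    simp

theorem freeMod.desc_basis (v : ∀ i, V.obj (o i)) {b : FIProd m} (i : ι) (f : o i ⟶ b) :
    ((freeMod.desc v).app b).hom (freeMod.basis k i f) = (V.map f).hom (v i) :=
  freeMod.lift_basis _ i f

theorem freeMod.inclMap_univ_injective (A : Finset (Pts n)) :
    Function.Injective (inclMap (freeMod k o) A.subset_univ) := by
  refine Finsupp.mapDomain_injective ?_
  rintro ⟨i, f⟩ ⟨i', f'⟩ h
  obtain rfl : i = i' := congrArg Sigma.fst h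
  simp only [freePush, Sigma.mk.injEq, heq_eq_eq, true_and] at h
  rw [subsetFunctor_map_injective _ h]

theorem freeMod.mem_range_inclMap_univ_iff {A : Finset (Pts n)}
    {w : (freeMod k o).obj ((subsetFunctor n).obj Finset.univ)} :
    w ∈ LinearMap.range (inclMap (freeMod k o) A.subset_univ) ↔
      ∀ p, freeMod.coeffs k o _ w p ≠ 0 → ptsImage p.2 ⊆ A := by
  classical
  constructor
  · rintro ⟨v, rfl⟩ p hp
    rw [inclMap, freeMod.coeffs_map] at hp
    obtain ⟨q, -, rfl⟩ := Finset.mem_image.1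
      (Finsupp.mapDomain_support (Finsupp.mem_support_iff.2 hp))
    exact (ptsImage_comp_map q.2 _).trans_subset (ptsImage_subset q.2)
  · refine fun hw => freeMod.mem_of_basis_mem fun i f hf => ?_
    obtain ⟨t, rfl⟩ := exists_comp_map_eq (homOfLE A.subset_univ) f (hw ⟨i, f⟩ hf)
    exact ⟨freeMod.basis k i t, freeMod.map_basis _ i t⟩

theorem freeMod.koszulExactAt_succ (n : Fin m → ℕ) (p : ℕ) :
    KoszulExactAt (freeMod k o) n (p + 1) := by
  intro x hx hdx
  let incl : Koszul (freeMod k o) n → Finset (Pts n) →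
      (Σ i, (o i ⟶ (subsetFunctor n).obj Finset.univ)) →₀ k :=
    fun y A => freeMod.coeffs k o _ (inclMap (freeMod k o) A.subset_univ (y A))
  have incl_d : ∀ y A, incl (Koszul.d y) A =
      ∑ s ∈ A, rankSign ptsRank s A • incl y (A.erase s) := by
    intro y A
    simp only [incl, Koszul.d_apply, map_sum, map_zsmul, inclMap_inclMap]
  have incl_eq_zero : ∀ A : Finset (Pts n), A.card + (p + 1) ≠ Fintype.card (Pts n) →
      incl x A = 0 := fun A hA => by
    simp only [incl, hx A hA, map_zero]
  obtain ⟨h, h_supp, h_zero, h_boundary⟩ := exists_cubeContraction_of_support_subset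
    ptsRank_injective (g := incl x)
    (fun A => freeMod.mem_range_inclMap_univ_iff.1 (LinearMap.mem_range_self _ (x A)))
    (incl_eq_zero _ (by rw [Finset.card_univ]; omega))
    (fun A => by rw [← incl_d, hdx]; simp only [incl, Pi.zero_apply, map_zero])
  obtain ⟨y, hy, incl_y⟩ := Koszul.exists_mem_homogeneous (V := freeMod k o) (p := p + 2)
    (P := fun A v => freeMod.coeffs k o _ (inclMap (freeMod k o) A.subset_univ v) = h A)
    (fun A hA => by
      rw [map_zero, map_zero, h_zero A fun s hs => incl_eq_zero _ ?_]
      rw [Finset.card_insert_of_notMem hs]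
      omega)
    (fun A _ => by
      obtain ⟨v, hv⟩ : (freeMod.coeffs k o _).symm (h A) ∈ LinearMap.range _ :=
        freeMod.mem_range_inclMap_univ_iff.2 fun q hq => h_supp A q
          (by rwa [LinearEquiv.apply_symm_apply] at hq)
      exact ⟨v, by rw [hv, LinearEquiv.apply_symm_apply]⟩)
  refine ⟨y, hy, funext fun A => freeMod.inclMap_univ_injective A
    ((freeMod.coeffs k o _).injective ?_)⟩
  exact (incl_d y A).trans ((Finset.sum_congr rfl fun s _ => by
    rw [← incl_y (A.erase s)]).trans (h_boundary A))

theorem KoszulExactAt.of_retract {V W : FIMod k m} {p : ℕ} (h : KoszulExactAt W n p)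
    (r : Retract V W) : KoszulExactAt V n p := by
  intro x hx hdx
  obtain ⟨y, hy, hdy⟩ := h (Koszul.map r.i x) (Koszul.map_mem_homogeneous hx r.i)
    (by rw [← Koszul.map_d, hdx, map_zero])
  refine ⟨Koszul.map r.r y, Koszul.map_mem_homogeneous hy r.r, ?_⟩
  rw [← Koszul.map_d, hdy]
  funext A
  exact congrArg (fun t : V ⟶ V => (t.app _).hom (x A)) r.retract

theorem koszulExactAt_succ_of_projective (P : FIMod k m) [Projective P] (n : Fin m → ℕ) (p : ℕ) :
    KoszulExactAt P n (p + 1) := by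
  let π : freeMod k (fun i : Σ a, P.obj a => i.1) ⟶ P := freeMod.desc fun i => i.2
  have epi_app : ∀ a, Epi (π.app a) := fun a => by
    rw [ModuleCat.epi_iff_surjective]
    exact fun v => ⟨freeMod.basis k ⟨a, v⟩ (𝟙 a), (freeMod.desc_basis _ _ _).trans (by simp)⟩
  have : Epi π := NatTrans.epi_of_epi_app π
  exact (freeMod.koszulExactAt_succ n p).of_retract
    ⟨Projective.factorThru (𝟙 P) π, π, Projective.factorThru_comp _ _⟩

end Free

/-! ### The universal Koszul complex is a chessboard complex -/

section Universal

variable {k : Type u} [CommRing k] {m : ℕ} {n : Fin m → ℕ} {V W : FIMod k m}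

/-- The free module representing the functor which sends `V` to its Koszul chains in degree `n`. -/
noncomputable abbrev koszulFree (k : Type u) [CommRing k] {m : ℕ} (n : Fin m → ℕ) : FIMod k m :=
  freeMod k fun A : ULift.{u} (Finset (Pts n)) => (subsetFunctor n).obj A.down

/-- The basis element of `koszulFree k n` given by a set of elements and a morphism out of it. -/
noncomputable abbrev koszulBasis (k : Type u) [CommRing k] {A : Finset (Pts n)} {b : FIProd m}
    (f : (subsetFunctor n).obj A ⟶ b) : (koszulFree k n).obj b :=
  freeMod.basis k (ULift.up A) f

/-- The universal Koszul chain. -/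
noncomputable def koszulUniv (k : Type u) [CommRing k] {m : ℕ} (n : Fin m → ℕ) :
    Koszul (koszulFree k n) n :=
  fun A => koszulBasis k (𝟙 ((subsetFunctor n).obj A))

/-- The map from the free module `koszulFree k n` which classifies a Koszul chain. -/
noncomputable def koszulHom (x : Koszul V n) : koszulFree k n ⟶ V :=
  freeMod.desc fun A => x A.down

theorem map_koszulBasis {A : Finset (Pts n)} {b c : FIProd m} (g : b ⟶ c)
    (f : (subsetFunctor n).obj A ⟶ b) :
    ((koszulFree k n).map g).hom (koszulBasis k f) = koszulBasis k (f ≫ g) :=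
  freeMod.map_basis (o := fun A : ULift.{u} (Finset (Pts n)) => (subsetFunctor n).obj A.down)
    g (ULift.up A) f

theorem koszulHom_basis (x : Koszul V n) {A : Finset (Pts n)} {b : FIProd m}
    (f : (subsetFunctor n).obj A ⟶ b) :
    ((koszulHom x).app b).hom (koszulBasis k f) = (V.map f).hom (x A) :=
  freeMod.desc_basis _ _ _

theorem map_koszulHom_koszulUniv (x : Koszul V n) :
    Koszul.map (koszulHom x) (koszulUniv k n) = x := by
  funext A
  refine (koszulHom_basis x _).trans ?_
  simp

theorem koszulFree_hom_ext {φ ψ : koszulFree k n ⟶ V}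
    (h : Koszul.map φ (koszulUniv k n) = Koszul.map ψ (koszulUniv k n)) : φ = ψ := by
  ext b : 2
  refine ModuleCat.hom_ext (freeMod.linearMap_ext fun A f => ?_)
  have basis_eq : freeMod.basis k A f = ((koszulFree k n).map f).hom (koszulUniv k n A.down) :=
    ((map_koszulBasis f _).trans (by rw [Category.id_comp])).symm
  rw [basis_eq]
  exact (NatTrans.naturality_apply φ f _).trans
    ((congrArg (V.map f).hom (congrFun h A.down)).trans (NatTrans.naturality_apply ψ f _).symm)

theorem koszulHom_comp (x : Koszul V n) (φ : V ⟶ W) :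
    koszulHom x ≫ φ = koszulHom (Koszul.map φ x) := by
  refine koszulFree_hom_ext ?_
  rw [map_koszulHom_koszulUniv]
  exact congrArg (Koszul.map φ) (map_koszulHom_koszulUniv x)

/-- The universal Koszul differential. -/
noncomputable def koszulBoundary (k : Type u) [CommRing k] {m : ℕ} (n : Fin m → ℕ) :
    koszulFree k n ⟶ koszulFree k n :=
  koszulHom (Koszul.d (koszulUniv k n))

theorem koszulBoundary_comp (x : Koszul V n) :
    koszulBoundary k n ≫ koszulHom x = koszulHom (Koszul.d x) := by
  rw [koszulBoundary, koszulHom_comp, Koszul.map_d, map_koszulHom_koszulUniv]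

theorem koszulBoundary_basis {A : Finset (Pts n)} {b : FIProd m}
    (f : (subsetFunctor n).obj A ⟶ b) :
    ((koszulBoundary k n).app b).hom (koszulBasis k f) =
      ∑ s ∈ A, rankSign ptsRank s A •
        koszulBasis k ((subsetFunctor n).map (homOfLE (Finset.erase_subset s A)) ≫ f) := by
  refine (koszulHom_basis _ f).trans ?_
  rw [Koszul.d_apply, map_sum]
  refine Finset.sum_congr rfl fun s _ => ?_
  rw [map_zsmul, inclMap, koszulUniv, map_koszulBasis, Category.id_comp]
  exact congrArg _ (map_koszulBasis f _)

/-- The submodule of the universal Koszul complex which classifies the chains of degree `p`. -/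
noncomputable def koszulFreeHomogeneous (k : Type u) [CommRing k] {m : ℕ} (n : Fin m → ℕ) (p : ℕ) :
    FISub (koszulFree k n) where
  carrier b := Submodule.span k {z | ∃ (A : Finset (Pts n)) (f : (subsetFunctor n).obj A ⟶ b),
    A.card + p = Fintype.card (Pts n) ∧ koszulBasis k f = z}
  map_mem {a b} g v hv := by
    refine (Submodule.map_span_le _ _ _).2 ?_ (Submodule.mem_map_of_mem hv)
    rintro _ ⟨A, f, hA, rfl⟩
    exact Submodule.subset_span ⟨A, f ≫ g, hA, (map_koszulBasis g f).symm⟩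

variable {b : FIProd m}

/-- The fields of the chessboard whose rows are the elements of `[n_1] × ⋯ × [n_m]` and whose
columns are the elements of `b`. -/
abbrev BoardField (n : Fin m → ℕ) (b : FIProd m) : Type :=
  Pts n × Pts fun j => (b j).card

/-- The graph of a morphism, as a placement of rooks. -/
noncomputable def rookGraph {A : Finset (Pts n)} (f : (subsetFunctor n).obj A ⟶ b) :
    Finset (BoardField n b) :=
  Finset.univ.image fun p : Σ j, Fin ((subsetFunctor n).obj A j).card =>
    (⟨p.1, ptsElt A p.1 p.2⟩, ⟨p.1, FI.toEmb (f p.1) p.2⟩)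

/-- The placements of non-attacking rooks on the chessboard of `n` and `b` which do not mix the
factors of `FI^m`. -/
abbrev fieldPlacements (n : Fin m → ℕ) (b : FIProd m) : Set (Finset (BoardField n b)) :=
  rookPlacements (fun x y => x.1 = y.1) Finset.univ Finset.univ

variable {A : Finset (Pts n)}

theorem mem_rookGraph {f : (subsetFunctor n).obj A ⟶ b} {v : BoardField n b} :
    v ∈ rookGraph f ↔ ∃ j i, v = (⟨j, ptsElt A j i⟩, ⟨j, FI.toEmb (f j) i⟩) := by
  simp only [rookGraph, Finset.mem_image, Finset.mem_univ, true_and, Sigma.exists, eq_comm]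

theorem rookGraph_mem_fieldPlacements (f : (subsetFunctor n).obj A ⟶ b) :
    rookGraph f ∈ fieldPlacements n b := by
  refine ⟨fun v hv => ?_, fun v hv w hw h => ?_⟩
  · obtain ⟨j, i, rfl⟩ := mem_rookGraph.1 hv
    exact ⟨Finset.mem_univ _, Finset.mem_univ _, rfl⟩
  · obtain ⟨j, i, rfl⟩ := mem_rookGraph.1 hv
    obtain ⟨j', i', rfl⟩ := mem_rookGraph.1 hw
    obtain rfl : j = j' := h.elim (congrArg Sigma.fst) (congrArg Sigma.fst)
    obtain rfl : i = i' := h.elim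
      (fun h => ptsElt_injective A j (eq_of_heq (Sigma.mk.inj h).2))
      (fun h => (FI.toEmb (f j)).injective (eq_of_heq (Sigma.mk.inj h).2))
    rfl

theorem image_fst_rookGraph (f : (subsetFunctor n).obj A ⟶ b) :
    (rookGraph f).image Prod.fst = A := by
  ext s
  simp only [Finset.mem_image, mem_rookGraph]
  constructor
  · rintro ⟨_, ⟨j, i, rfl⟩, rfl⟩
    exact ptsElt_mem A j i
  · intro hs
    obtain ⟨i, hi⟩ := exists_ptsElt (A := A) (j := s.1) (i := s.2) hs
    exact ⟨_, ⟨s.1, i, rfl⟩, by rw [hi]⟩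

theorem rookGraph_fst_injOn (f : (subsetFunctor n).obj A ⟶ b) :
    Set.InjOn Prod.fst (rookGraph f : Set (BoardField n b)) :=
  fun v hv w hw h => (rookGraph_mem_fieldPlacements f).2 v hv w hw (Or.inl h)

theorem card_rookGraph (f : (subsetFunctor n).obj A ⟶ b) : (rookGraph f).card = A.card := by
  rw [← Finset.card_image_of_injOn (rookGraph_fst_injOn f), image_fst_rookGraph]

theorem rookGraph_comp_map_subset {B : Finset (Pts n)} (h : B ⟶ A)
    (f : (subsetFunctor n).obj A ⟶ b) : rookGraph ((subsetFunctor n).map h ≫ f) ⊆ rookGraph f := by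
  intro w hw
  obtain ⟨j, i, rfl⟩ := mem_rookGraph.1 hw
  exact mem_rookGraph.2 ⟨j, FI.toEmb ((subsetFunctor n).map h j) i, by rw [ptsElt_map]; rfl⟩

theorem rookGraph_erase (f : (subsetFunctor n).obj A ⟶ b) {v : BoardField n b}
    (hv : v ∈ rookGraph f) :
    rookGraph ((subsetFunctor n).map (homOfLE (Finset.erase_subset v.1 A)) ≫ f) =
      (rookGraph f).erase v := by
  have fst_mem : v.1 ∈ A := image_fst_rookGraph f ▸ Finset.mem_image_of_mem _ hv
  refine Finset.eq_of_subset_of_card_le (fun w hw => ?_) ?_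
  · refine Finset.mem_erase.2 ⟨?_, rookGraph_comp_map_subset _ f hw⟩
    rintro rfl
    have := Finset.mem_image_of_mem Prod.fst hw
    rw [image_fst_rookGraph] at this
    exact Finset.notMem_erase _ _ this
  · rw [Finset.card_erase_of_mem hv, card_rookGraph, card_rookGraph,
      Finset.card_erase_of_mem fst_mem]

/-- The lexicographic rank of the fields of a chessboard. -/
noncomputable def fieldRank (v : BoardField n b) : ℕ ×ₗ ℕ :=
  toLex (ptsRank v.1, ptsRank v.2)

theorem fieldRank_injective : Function.Injective (fieldRank (n := n) (b := b)) :=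
  toLex.injective.comp (ptsRank_injective.prodMap ptsRank_injective)

theorem rankSign_rookGraph (f : (subsetFunctor n).obj A ⟶ b) {v : BoardField n b}
    (hv : v ∈ rookGraph f) : rankSign fieldRank v (rookGraph f) = rankSign ptsRank v.1 A := by
  have below_v : (rookGraph f).filter (fun w => fieldRank w < fieldRank v) =
      (rookGraph f).filter fun w => ptsRank w.1 < ptsRank v.1 := by
    refine Finset.filter_congr fun w hw => ?_
    rw [fieldRank, fieldRank, Prod.Lex.toLex_lt_toLex]
    refine ⟨?_, Or.inl⟩
    rintro (h | ⟨h, h'⟩)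
    · exact h
    · rw [rookGraph_fst_injOn f hw hv (ptsRank_injective h)] at h'
      exact absurd h' (lt_irrefl _)
  have below_fst : A.filter (fun s => ptsRank s < ptsRank v.1) =
      ((rookGraph f).filter fun w => ptsRank w.1 < ptsRank v.1).image Prod.fst := by
    conv_lhs => rw [← image_fst_rookGraph f]
    rw [Finset.filter_image]
  rw [rankSign, rankSign, below_v, below_fst, Finset.card_image_of_injOn
    ((rookGraph_fst_injOn f).mono (Finset.coe_subset.2 (Finset.filter_subset _ _)))]

theorem eq_of_rookGraph_eq {f g : (subsetFunctor n).obj A ⟶ b} (h : rookGraph f = rookGraph g) :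
    f = g := by
  funext j
  refine Function.Embedding.ext fun i => ?_
  have graph_mem : ((⟨j, ptsElt A j i⟩, ⟨j, FI.toEmb (f j) i⟩) : BoardField n b) ∈ rookGraph g :=
    h ▸ mem_rookGraph.2 ⟨j, i, rfl⟩
  obtain ⟨j', i', h'⟩ := mem_rookGraph.1 graph_mem
  obtain ⟨h_row, h_col⟩ := Prod.mk.inj h'
  obtain rfl : j = j' := congrArg Sigma.fst h_row
  obtain rfl : i = i' := ptsElt_injective A j (eq_of_heq (Sigma.mk.inj h_row).2)
  exact eq_of_heq (Sigma.mk.inj h_col).2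

theorem exists_rookGraph_eq {σ : Finset (BoardField n b)} (hσ : σ ∈ fieldPlacements n b) :
    ∃ (A : Finset (Pts n)) (f : (subsetFunctor n).obj A ⟶ b), rookGraph f = σ := by
  let A := σ.image Prod.fst
  have exists_column : ∀ j i, ∃ y : Fin (b j).card,
      ((⟨j, ptsElt A j i⟩, ⟨j, y⟩) : BoardField n b) ∈ σ := by
    intro j i
    obtain ⟨⟨s, j', y⟩, hv, hs⟩ := Finset.mem_image.1 (ptsElt_mem A j i)
    obtain rfl : s = _ := hs
    obtain rfl : j = j' := (hσ.1 _ hv).2.2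
    exact ⟨y, hv⟩
  choose y hy using exists_column
  have y_injective : ∀ j, Function.Injective (y j) := fun j i i' hii' =>
    ptsElt_injective A j (eq_of_heq (Sigma.mk.inj
      (congrArg Prod.fst (hσ.2 _ (hy j i) _ (hy j i') (Or.inr (by rw [hii']))))).2)
  refine ⟨A, fun j => (⟨y j, y_injective j⟩ : _ ↪ Fin (b j).card),
    Finset.Subset.antisymm (fun v hv => ?_) fun v hv => ?_⟩
  · obtain ⟨j, i, rfl⟩ := mem_rookGraph.1 hv
    exact hy j i
  · have fst_mem : v.1 ∈ A := Finset.mem_image_of_mem _ hv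
    obtain ⟨i, hi⟩ := exists_ptsElt (j := v.1.1) (i := v.1.2) fst_mem
    exact mem_rookGraph.2 ⟨v.1.1, i, hσ.2 _ hv _ (hy v.1.1 i) (Or.inl (by rw [hi]))⟩

/-- The comparison of the universal Koszul complex with the chains on a chessboard. -/
noncomputable def toChessboard (k : Type u) [CommRing k] {m : ℕ} (n : Fin m → ℕ) (b : FIProd m) :
    (koszulFree k n).obj b →ₗ[k] (Finset (BoardField n b) →₀ k) :=
  Finsupp.lmapDomain k k
    fun p : Σ A : ULift.{u} (Finset (Pts n)), (subsetFunctor n).obj A.down ⟶ b => rookGraph p.2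

theorem toChessboard_basis (f : (subsetFunctor n).obj A ⟶ b) :
    toChessboard k n b (koszulBasis k f) = Finsupp.single (rookGraph f) 1 :=
  Finsupp.mapDomain_single

theorem toChessboard_injective : Function.Injective (toChessboard k n b) := by
  refine Finsupp.mapDomain_injective ?_
  rintro ⟨⟨A⟩, f⟩ ⟨⟨B⟩, g⟩ (h : rookGraph f = rookGraph g)
  obtain rfl : A = B := (image_fst_rookGraph f).symm.trans (h ▸ image_fst_rookGraph g)
  rw [eq_of_rookGraph_eq h]

theorem supported_fieldPlacements_le_range_toChessboard :
    Finsupp.supported k k (fieldPlacements n b) ≤ LinearMap.range (toChessboard k n b) := by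
  rw [Finsupp.supported_eq_span_single, Submodule.span_le]
  rintro _ ⟨σ, hσ, rfl⟩
  obtain ⟨A, f, rfl⟩ := exists_rookGraph_eq hσ
  exact ⟨_, toChessboard_basis f⟩

theorem toChessboard_mem_supported {p : ℕ} {z : (koszulFree k n).obj b}
    (hz : z ∈ (koszulFreeHomogeneous k n p).carrier b) :
    toChessboard k n b z ∈ Finsupp.supported k k
      {σ ∈ fieldPlacements n b | σ.card + p = Fintype.card (Pts n)} := by
  refine (Submodule.map_span_le _ _ _).2 ?_ (Submodule.mem_map_of_mem hz)
  rintro _ ⟨A, f, hA, rfl⟩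
  rw [toChessboard_basis]
  refine Finsupp.single_mem_supported k _ ⟨rookGraph_mem_fieldPlacements f, ?_⟩
  rwa [card_rookGraph]

theorem toChessboard_boundary (z : (koszulFree k n).obj b) :
    toChessboard k n b (((koszulBoundary k n).app b).hom z) =
      simplexBoundary k fieldRank (toChessboard k n b z) := by
  suffices h : toChessboard k n b ∘ₗ ((koszulBoundary k n).app b).hom =
      simplexBoundary k fieldRank ∘ₗ toChessboard k n b from LinearMap.congr_fun h z
  refine freeMod.linearMap_ext fun A f => ?_
  rw [LinearMap.comp_apply, LinearMap.comp_apply, toChessboard_basis, koszulBoundary_basis,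
    map_sum]
  simp only [simplexBoundary, LinearMap.sum_apply]
  rw [← Finset.sum_subset (Finset.subset_univ (rookGraph f))
    fun v _ hv => contractVertex_single_of_notMem hv]
  refine (Finset.sum_nbij Prod.fst (fun v hv => ?_) (rookGraph_fst_injOn f) (fun s hs => ?_)
    fun v hv => ?_).symm
  · exact (image_fst_rookGraph f).subset (Finset.mem_image_of_mem _ hv)
  · simpa using (image_fst_rookGraph f).superset hs
  · rw [contractVertex_single_of_mem hv, map_zsmul, toChessboard_basis, rankSign_rookGraph f hv,
      rookGraph_erase f hv]

theorem card_filter_fst_eq (n : Fin m → ℕ) (j : Fin m) :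
    (Finset.univ.filter fun s : Pts n => j = s.1).card = n j := by
  have fiber_eq : (Finset.univ.filter fun s : Pts n => j = s.1) =
      (Finset.univ : Finset (Fin (n j))).map (Function.Embedding.sigmaMk j) := by
    ext ⟨j', i⟩
    simp only [Finset.mem_filter, Finset.mem_univ, true_and, Finset.mem_map,
      Function.Embedding.sigmaMk_apply]
    constructor
    · rintro rfl
      exact ⟨i, rfl⟩
    · rintro ⟨i', h⟩
      exact congrArg Sigma.fst h
  rw [fiber_eq, Finset.card_map, Finset.card_fin]

theorem exists_koszulBoundary_eq {p : ℕ} (hb : ∀ j, 2 * Fintype.card (Pts n) ≤ (b j).card)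
    {z : (koszulFree k n).obj b} (hz : z ∈ (koszulFreeHomogeneous k n (p + 1)).carrier b)
    (hdz : ((koszulBoundary k n).app b).hom z = 0) :
    ∃ w, ((koszulBoundary k n).app b).hom w = z := by
  have acyclic : RookAcyclic k (fieldRank (n := n) (b := b)) (fun x y => x.1 = y.1)
      Finset.univ Finset.univ := by
    refine rookAcyclic_of_two_mul_card_le fieldRank_injective fun x _ => ?_
    rw [card_filter_fst_eq]
    exact hb x.1
  have not_full : {σ ∈ fieldPlacements n b | σ.card + (p + 1) = Fintype.card (Pts n)} ⊆
      {σ ∈ fieldPlacements n b | σ.card < (Finset.univ : Finset (Pts n)).card} := by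
    refine fun σ hσ => ⟨hσ.1, ?_⟩
    rw [Finset.card_univ, ← hσ.2]
    omega
  obtain ⟨w, hw, hdw⟩ := acyclic (toChessboard k n b z)
    (Finsupp.supported_mono not_full (toChessboard_mem_supported hz))
    (by rw [← toChessboard_boundary, hdz, map_zero])
  obtain ⟨w, rfl⟩ := supported_fieldPlacements_le_range_toChessboard hw
  exact ⟨w, toChessboard_injective (by rw [toChessboard_boundary, hdw])⟩

end Universal

/-! ### Koszul chains of injective modules modulo torsion -/

section Injective

variable {k : Type u} [CommRing k] {m : ℕ}

/-- The inclusion of a submodule. -/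
noncomputable def FISub.incl {V : FIMod k m} (W : FISub V) : W.toMod ⟶ V where
  app a := ModuleCat.ofHom (W.carrier a).subtype
  naturality _ _ _ := rfl

/-- The projection to a quotient module. -/
noncomputable def FISub.proj {V : FIMod k m} (W : FISub V) : V ⟶ W.quot where
  app a := ModuleCat.ofHom (W.carrier a).mkQ
  naturality _ _ _ := rfl

theorem FISub.proj_eq_zero_iff {V : FIMod k m} (W : FISub V) {b : FIProd m} {v : V.obj b} :
    (W.proj.app b).hom v = 0 ↔ v ∈ W.carrier b :=
  Submodule.Quotient.mk_eq_zero _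

theorem exists_factorization_of_injective {Z Q I : FIMod k m} [Injective I] (g : Z ⟶ Q)
    (φ : Z ⟶ I) (h : ∀ b (z : Z.obj b), (g.app b).hom z = 0 → (φ.app b).hom z = 0) :
    ∃ ψ : Q ⟶ I, ∀ b (z : Z.obj b), (ψ.app b).hom ((g.app b).hom z) = (φ.app b).hom z := by
  have kernel_comp : kernel.ι g ≫ φ = 0 := by
    ext b : 2
    refine ModuleCat.hom_ext (LinearMap.ext fun z => h b _ ?_)
    exact congrArg (fun t : kernel g ⟶ Q => (t.app b).hom z) (kernel.condition g)
  have exact_kernel := ShortComplex.exact_kernel g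
  exact ⟨exact_kernel.descToInjective φ kernel_comp, fun b z =>
    congrArg (fun t : Z ⟶ I => (t.app b).hom z) (exact_kernel.comp_descToInjective φ kernel_comp)⟩

open Classical in
/-- The submodule of `V` which is everything in the large degrees and zero elsewhere. -/
noncomputable def FIMod.large (V : FIMod k m) (D : ℕ) : FISub V where
  carrier b := if ∀ j, D ≤ (b j).card then ⊤ else ⊥
  map_mem {a b} f v hv := by
    split_ifs at hv ⊢ with ha hb hb
    · trivial
    · trivial
    · exact absurd (fun j => (hb j).trans (FI.card_le (f j))) ha
    · rw [(Submodule.mem_bot k).1 hv, map_zero]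
      exact zero_mem _

theorem FIMod.large_carrier_eq_top (V : FIMod k m) {D : ℕ} {b : FIProd m}
    (hb : ∀ j, D ≤ (b j).card) : (V.large D).carrier b = ⊤ := if_pos hb

theorem FIMod.large_carrier_eq_bot (V : FIMod k m) {D : ℕ} {b : FIProd m}
    (hb : ¬∀ j, D ≤ (b j).card) : (V.large D).carrier b = ⊥ := if_neg hb

theorem FIMod.torsion_quot_large [NeZero m] (V : FIMod k m) (D : ℕ) (a : FIProd m) :
    (V.large D).quot.torsion.carrier a = ⊤ := by
  refine eq_top_iff.2 fun v _ => ?_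
  obtain ⟨v, rfl⟩ := Submodule.Quotient.mk_surjective _ v
  obtain ⟨c, g, hg, hc, -⟩ := FIProd.exists_large a (fun _ => ⟨D⟩) a
  refine ⟨c, g, hg, (V.large D).proj_eq_zero_iff.2 ?_⟩
  rw [V.large_carrier_eq_top hc]
  trivial

variable {n : Fin m → ℕ} {I : FIMod k m} {p : ℕ}

/-- The submodule of the universal Koszul complex formed by the cycles of degree `p`. -/
noncomputable def koszulFreeCycles (k : Type u) [CommRing k] {m : ℕ} (n : Fin m → ℕ) (p : ℕ) :
    FISub (koszulFree k n) where
  carrier b := (koszulFreeHomogeneous k n p).carrier b ⊓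
    LinearMap.ker ((koszulBoundary k n).app b).hom
  map_mem {a b} g v hv := by
    refine ⟨(koszulFreeHomogeneous k n p).map_mem g v hv.1, ?_⟩
    refine (NatTrans.naturality_apply (koszulBoundary k n) g v).trans ?_
    exact (congrArg _ (LinearMap.mem_ker.1 hv.2)).trans (map_zero _)

theorem exists_koszulHom_app_eq_zero [NeZero m] {x : Koszul I n} (hx : x ∈ Koszul.torsion I n) :
    ∃ D, ∀ c : FIProd m, (∀ j, D ≤ (c j).card) → ((koszulHom x).app c).hom = 0 := by
  choose b f _ hf using fun A => hx A trivial
  refine ⟨∑ A, ∑ j, (b A j).card, fun c hc => freeMod.linearMap_ext fun A g => ?_⟩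
  rw [koszulHom_basis, LinearMap.zero_apply]
  refine I.map_eq_zero_of_card_le (f A.down) (hf A.down) g fun j => le_trans ?_ (hc j)
  calc (b A.down j).card
      ≤ ∑ j, (b A.down j).card :=
        Finset.single_le_sum (f := fun j => (b A.down j).card) (by simp) (Finset.mem_univ j)
    _ ≤ ∑ A, ∑ j, (b A j).card :=
        Finset.single_le_sum (f := fun A => ∑ j, (b A j).card) (by simp) (Finset.mem_univ A.down)

theorem koszulHom_eq_zero_of_mem_cycles {x : Koszul I n} {c : FIProd m}
    (hc : ∀ j, 2 * Fintype.card (Pts n) ≤ (c j).card)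
    (hdx : ((koszulHom (Koszul.d x)).app c).hom = 0) {z : (koszulFree k n).obj c}
    (hz : z ∈ (koszulFreeCycles k n (p + 1)).carrier c) : ((koszulHom x).app c).hom z = 0 := by
  obtain ⟨w, rfl⟩ := exists_koszulBoundary_eq hc hz.1 (LinearMap.mem_ker.1 hz.2)
  rw [← koszulBoundary_comp] at hdx
  exact LinearMap.congr_fun hdx w

theorem exists_torsion_valued_eq_koszulHom [NeZero m] [Injective I] {x : Koszul I n}
    (hdx : Koszul.d x ∈ Koszul.torsion I n) (p : ℕ) :
    ∃ τ : koszulFree k n ⟶ I, (∀ b v, (τ.app b).hom v ∈ I.torsion.carrier b) ∧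
      ∀ b, ∀ z ∈ (koszulFreeCycles k n (p + 1)).carrier b,
        (τ.app b).hom z = ((koszulHom x).app b).hom z := by
  obtain ⟨D, hD⟩ := exists_koszulHom_app_eq_zero hdx
  let Z := koszulFreeCycles k n (p + 1)
  let U := (koszulFree k n).large (D + 2 * Fintype.card (Pts n))
  -- The values are torsion because the map factors through the torsion module `U.quot`.
  obtain ⟨ψ, hψ⟩ := exists_factorization_of_injective (Z.incl ≫ U.proj) (Z.incl ≫ koszulHom x) <| by
    intro c z hz
    have mem_large : z.1 ∈ U.carrier c := U.proj_eq_zero_iff.1 hz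
    by_cases hc : ∀ j, D + 2 * Fintype.card (Pts n) ≤ (c j).card
    · exact koszulHom_eq_zero_of_mem_cycles (fun j => (Nat.le_add_left _ _).trans (hc j))
        (hD c fun j => (Nat.le_add_right _ _).trans (hc j)) z.2
    · rw [FIMod.large_carrier_eq_bot _ hc] at mem_large
      exact (congrArg ((koszulHom x).app c).hom ((Submodule.mem_bot k).1 mem_large)).trans
        (map_zero _)
  refine ⟨U.proj ≫ ψ, fun b v => ?_, fun b z hz => hψ b ⟨z, hz⟩⟩
  exact FIMod.torsion_map ψ b _ (by rw [FIMod.torsion_quot_large]; trivial)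

theorem exists_homogeneous_d_eq (y : Koszul I n) (p : ℕ) :
    ∃ y' ∈ Koszul.homogeneous I n (p + 1), ∀ A : Finset (Pts n),
      A.card + p = Fintype.card (Pts n) → Koszul.d y' A = Koszul.d y A := by
  obtain ⟨y', hy', eq_y⟩ := Koszul.exists_mem_homogeneous (V := I) (n := n) (p := p + 1)
    (P := fun A v => A.card + (p + 1) = Fintype.card (Pts n) → v = y A)
    (fun A hA hA' => absurd hA' hA) fun A _ => ⟨y A, fun _ => rfl⟩
  refine ⟨y', hy', fun A hA => Finset.sum_congr rfl fun s hs => ?_⟩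
  have := Finset.card_erase_add_one hs
  rw [eq_y _ (by omega)]

theorem exists_d_eq_of_eq_zero_on_cycles [Injective I] (φ : koszulFree k n ⟶ I)
    (h : ∀ b, ∀ z ∈ (koszulFreeCycles k n p).carrier b, (φ.app b).hom z = 0) :
    ∃ y ∈ Koszul.homogeneous I n (p + 1), ∀ A : Finset (Pts n),
      A.card + p = Fintype.card (Pts n) → Koszul.d y A = Koszul.map φ (koszulUniv k n) A := by
  let H := koszulFreeHomogeneous k n p
  obtain ⟨η, hη⟩ := exists_factorization_of_injective (H.incl ≫ koszulBoundary k n) (H.incl ≫ φ)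
    fun b z hz => h b z.1 ⟨z.2, LinearMap.mem_ker.2 hz⟩
  obtain ⟨y, hy, d_y⟩ := exists_homogeneous_d_eq (Koszul.map η (koszulUniv k n)) p
  refine ⟨y, hy, fun A hA => ?_⟩
  have boundary_univ := congrFun (map_koszulHom_koszulUniv (Koszul.d (koszulUniv k n))) A
  rw [d_y A hA, ← Koszul.map_d, Koszul.map_apply, ← boundary_univ]
  exact hη _ ⟨koszulUniv k n A, Submodule.subset_span ⟨A, 𝟙 _, hA, rfl⟩⟩

theorem koszulExactModTorsionAt_succ_of_injective [NeZero m] (I : FIMod k m) [Injective I]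
    (n : Fin m → ℕ) (p : ℕ) : KoszulExactModTorsionAt I n (p + 1) := by
  intro x hx hdx
  obtain ⟨τ, τ_mem, τ_eq⟩ := exists_torsion_valued_eq_koszulHom hdx p
  obtain ⟨y, hy, d_y⟩ := exists_d_eq_of_eq_zero_on_cycles (p := p + 1) (koszulHom x - τ)
    fun b z hz => sub_eq_zero.2 (τ_eq b z hz).symm
  refine ⟨y, hy, fun A _ => ?_⟩
  rw [Pi.sub_apply]
  by_cases hA : A.card + (p + 1) = Fintype.card (Pts n)
  · have diff_eq : x A - Koszul.d y A = (τ.app _).hom (koszulUniv k n A) := by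
      rw [d_y A hA, sub_eq_iff_eq_add']
      refine Eq.trans ?_ (sub_add_cancel _ _).symm
      exact (congrFun (map_koszulHom_koszulUniv x) A).symm
    rw [diff_eq]
    exact τ_mem _ _
  · rw [hx A hA, Koszul.d_mem_homogeneous hy A hA, sub_zero]
    exact zero_mem _

end Injective

/-! ### Chases in Koszul double complexes -/

section Chase

variable {k : Type u} [CommRing k] {m : ℕ}

theorem subsingleton_homology_obj_iff (S : ShortComplex (FIMod k m)) (a : FIProd m) :
    Subsingleton (S.homology.obj a) ↔ ∀ x : S.X₂.obj a, (S.g.app a).hom x = 0 →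
      ∃ y : S.X₁.obj a, (S.f.app a).hom y = x := by
  let F := (evaluation (FIProd m) (ModuleCat.{u} k)).obj a
  have subsingleton_iff : Subsingleton (S.homology.obj a) ↔ IsZero (F.obj S.homology) :=
    (ModuleCat.isZero_iff_subsingleton (M := S.homology.obj a)).symm
  rw [subsingleton_iff, ← (S.mapHomologyIso F).isZero_iff,
    ← ShortComplex.exact_iff_isZero_homology, ShortComplex.moduleCat_exact_iff]
  rfl

theorem exists_app_eq_of_exact {S : ShortComplex (FIMod k m)} (hS : S.Exact) {a : FIProd m}
    {x : S.X₂.obj a} (hx : (S.g.app a).hom x = 0) : ∃ y : S.X₁.obj a, (S.f.app a).hom y = x := by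
  refine (subsingleton_homology_obj_iff S a).1 ?_ x hx
  exact ModuleCat.isZero_iff_subsingleton.1 (((evaluation (FIProd m) (ModuleCat.{u} k)).obj
    a).map_isZero ((ShortComplex.exact_iff_isZero_homology S).1 hS))

variable {n : Fin m → ℕ} {p : ℕ}

theorem Koszul.map_map_eq_zero {U V W : FIMod k m} {φ : U ⟶ V} {ψ : V ⟶ W} (h : φ ≫ ψ = 0)
    (x : Koszul U n) : Koszul.map ψ (Koszul.map φ x) = 0 := by
  funext A
  exact congrArg (fun t : U ⟶ W => (t.app _).hom (x A)) h

theorem Koszul.exists_map_eq_of_exact {S : ShortComplex (FIMod k m)} (hS : S.Exact)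
    {x : Koszul S.X₂ n} (hx : x ∈ Koszul.homogeneous S.X₂ n p) (hgx : Koszul.map S.g x = 0) :
    ∃ y ∈ Koszul.homogeneous S.X₁ n p, Koszul.map S.f y = x := by
  obtain ⟨y, hy, map_y⟩ := Koszul.exists_mem_homogeneous (V := S.X₁) (p := p)
    (P := fun A v => (S.f.app _).hom v = x A) (fun A hA => by rw [map_zero, hx A hA])
    fun A _ => exists_app_eq_of_exact hS (congrFun hgx A)
  exact ⟨y, hy, funext map_y⟩

theorem Koszul.exists_map_eq_of_epi {V W : FIMod k m} (φ : V ⟶ W) [Epi φ] {x : Koszul W n}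
    (hx : x ∈ Koszul.homogeneous W n p) : ∃ y ∈ Koszul.homogeneous V n p, Koszul.map φ y = x :=
  Koszul.exists_map_eq_of_exact (S := ShortComplex.mk φ (0 : W ⟶ W) comp_zero)
    ((ShortComplex.exact_iff_epi _ rfl).2 ‹_›) hx rfl

theorem Koszul.exists_map_add_d_eq {E : ChainComplex (FIMod k m) ℕ} [Epi (E.d 1 0)]
    (hE : ∀ q, (ShortComplex.mk _ _ (E.d_comp_d (q + 2) (q + 1) q)).Exact) {i : ℕ}
    (hK : ∀ q p, p + 1 + q = i → KoszulExactAt (E.X q) n (p + 1)) (q : ℕ) {p : ℕ} (hp : p + q = i)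
    {x : Koszul (E.X (q + 1)) n} (hx : x ∈ Koszul.homogeneous _ n p)
    {v : Koszul (E.X q) n} (hv : v ∈ Koszul.homogeneous _ n (p + 1))
    (hxv : Koszul.map (E.d (q + 1) q) x = Koszul.d v) :
    ∃ y ∈ Koszul.homogeneous (E.X (q + 2)) n p, ∃ z ∈ Koszul.homogeneous (E.X (q + 1)) n (p + 1),
      Koszul.map (E.d (q + 2) (q + 1)) y + Koszul.d z = x := by
  suffices exists_lift : ∃ z ∈ Koszul.homogeneous (E.X (q + 1)) n (p + 1),
      Koszul.d (Koszul.map (E.d (q + 1) q) z) = Koszul.d v by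
    obtain ⟨z, hz, hzv⟩ := exists_lift
    obtain ⟨y, hy, map_y⟩ := Koszul.exists_map_eq_of_exact (hE q)
      (sub_mem hx (Koszul.d_mem_homogeneous hz)) (by rw [map_sub, hxv, Koszul.map_d, hzv, sub_self])
    exact ⟨y, hy, z, hz, sub_eq_iff_eq_add.1 map_y.symm |>.symm⟩
  induction q generalizing p with
  | zero =>
    obtain ⟨z, hz, rfl⟩ := Koszul.exists_map_eq_of_epi (E.d 1 0) hv
    exact ⟨z, hz, rfl⟩
  | succ q ih =>
    have d_map_v : Koszul.d (Koszul.map (E.d (q + 1) q) v) = 0 := by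
      rw [← Koszul.map_d, ← hxv, Koszul.map_map_eq_zero (E.d_comp_d _ _ _)]
    obtain ⟨w, hw, hwv⟩ := hK q p (by omega) _ (Koszul.map_mem_homogeneous hv _) d_map_v
    obtain ⟨z, hz, hzw⟩ := ih (p := p + 1) (by omega) hv hw hwv.symm
    obtain ⟨y, hy, map_y⟩ := Koszul.exists_map_eq_of_exact (hE q)
      (sub_mem hv (Koszul.d_mem_homogeneous hz))
      (by rw [map_sub, Koszul.map_d, hzw, hwv, sub_self])
    exact ⟨y, hy, by rw [map_y, map_sub, Koszul.d_d, sub_zero]⟩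

variable [NeZero m]

theorem Koszul.map_mem_torsion {V W : FIMod k m} {x : Koszul V n} (hx : x ∈ Koszul.torsion V n)
    (φ : V ⟶ W) : Koszul.map φ x ∈ Koszul.torsion W n :=
  fun A hA => FIMod.torsion_map φ _ _ (hx A hA)

theorem Koszul.d_mem_torsion {V : FIMod k m} {x : Koszul V n} (hx : x ∈ Koszul.torsion V n) :
    Koszul.d x ∈ Koszul.torsion V n :=
  fun A _ => sum_mem fun s _ => zsmul_mem (V.torsion.map_mem _ _ (hx (A.erase s) trivial)) _

theorem Koszul.exists_mem_torsion_add_d_eq {I : CochainComplex (FIMod k m) ℕ}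
    (hI : ∀ q, (ShortComplex.mk _ _ (I.d_comp_d q (q + 1) (q + 2))).Exact) {i : ℕ}
    (hK : ∀ q, KoszulExactModTorsionAt (I.X q) n (i + q))
    (htors : ∀ q, ∀ t ∈ Koszul.homogeneous (I.X (q + 1)) n (i + (q + 1)) ⊓ Koszul.torsion _ n,
      Koszul.map (I.d (q + 1) (q + 2)) t = 0 →
        ∃ s ∈ Koszul.homogeneous (I.X q) n (i + (q + 1)) ⊓ Koszul.torsion _ n,
          Koszul.map (I.d q (q + 1)) s = t)
    (q : ℕ) {v : Koszul (I.X q) n} (hv : v ∈ Koszul.homogeneous _ n (i + q))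
    (map_v : Koszul.map (I.d q (q + 1)) v = 0) (d_v : Koszul.d v ∈ Koszul.torsion _ n) :
    ∃ t ∈ Koszul.homogeneous (I.X q) n (i + q) ⊓ Koszul.torsion (I.X q) n,
      ∃ y ∈ Koszul.homogeneous (I.X q) n (i + q + 1),
        Koszul.map (I.d q (q + 1)) t = 0 ∧ Koszul.map (I.d q (q + 1)) y = 0 ∧
          t + Koszul.d y = v := by
  induction hl : Fintype.card (Pts n) + 1 - (i + q) generalizing q with
  | zero =>
    have v_eq : v = 0 := funext fun A => hv A (by omega)
    exact ⟨0, zero_mem _, 0, zero_mem _, map_zero _, map_zero _, by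
      rw [v_eq, map_zero, add_zero]⟩
  | succ l ih =>
    obtain ⟨y₀, hy₀, torsion_sub⟩ := hK q v hv d_v
    have map_sub_eq : Koszul.map (I.d q (q + 1)) (v - Koszul.d y₀) =
        -Koszul.d (Koszul.map (I.d q (q + 1)) y₀) := by
      rw [map_sub, map_v, zero_sub, Koszul.map_d]
    obtain ⟨t₁, ht₁, y₁, hy₁, map_t₁, map_y₁, sum_eq⟩ := ih (q + 1)
      (Koszul.map_mem_homogeneous hy₀ _) (Koszul.map_map_eq_zero (I.d_comp_d _ _ _) y₀)
      (neg_mem_iff.1 (map_sub_eq ▸ Koszul.map_mem_torsion torsion_sub _)) (by omega)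
    obtain ⟨s, ⟨hs, torsion_s⟩, map_s⟩ := htors q t₁ ht₁ map_t₁
    obtain ⟨w, hw, map_w⟩ := Koszul.exists_map_eq_of_exact (hI q) hy₁ map_y₁
    refine ⟨v - Koszul.d y₀ + Koszul.d s, ⟨add_mem (sub_mem hv (Koszul.d_mem_homogeneous hy₀))
      (Koszul.d_mem_homogeneous hs), add_mem torsion_sub (Koszul.d_mem_torsion torsion_s)⟩,
      y₀ - s - Koszul.d w, sub_mem (sub_mem hy₀ hs) (Koszul.d_mem_homogeneous hw), ?_, ?_, ?_⟩
    · rw [map_add, map_sub_eq, ← sum_eq, map_add, Koszul.d_d, Koszul.map_d, map_s]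
      abel
    · rw [map_sub, map_sub, Koszul.map_d, map_s, map_w, ← sum_eq]
      abel
    · rw [map_sub, map_sub, Koszul.d_d]
      abel

end Chase

/-! ### Koszul homology, `FI^m`-homology and local cohomology -/

section Derived

variable {k : Type u} [CommRing k] {m : ℕ} {n : Fin m → ℕ} {V : FIMod k m}

theorem FIMod.lt_carrier_eq_range_d (V : FIMod k m) (A : Finset (Pts n)) :
    V.lt.carrier ((subsetFunctor n).obj A) =
      LinearMap.range (LinearMap.proj A ∘ₗ Koszul.d (V := V) (n := n)) := by
  refine le_antisymm (Submodule.span_le.2 ?_) ?_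
  · rintro _ ⟨a, f, w, hf, rfl⟩
    obtain ⟨s, hs, t, rfl⟩ := exists_factor_erase f hf
    refine ⟨Pi.single (A.erase s) (rankSign ptsRank s A • (V.map t).hom w), ?_⟩
    rw [LinearMap.comp_apply, LinearMap.proj_apply, Koszul.d_apply,
      Finset.sum_eq_single_of_mem s hs]
    · rw [Pi.single_eq_same, map_zsmul, smul_smul, rankSign_mul_self, one_smul, V.map_comp]
      rfl
    · intro s' hs' hne
      have erase_ne : A.erase s' ≠ A.erase s := fun h =>
        Finset.notMem_erase s' A (h ▸ Finset.mem_erase.2 ⟨hne, hs'⟩)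
      rw [Pi.single_eq_of_ne erase_ne, map_zero, smul_zero]
  · rintro _ ⟨x, rfl⟩
    refine sum_mem fun s hs => zsmul_mem (Submodule.subset_span ?_) _
    exact ⟨_, _, x (A.erase s), isTransition_map_erase hs _, rfl⟩

theorem Koszul.eq_of_apply_univ_eq {x y : Koszul V n} (hx : x ∈ Koszul.homogeneous V n 0)
    (hy : y ∈ Koszul.homogeneous V n 0) (h : x Finset.univ = y Finset.univ) : x = y := by
  funext A
  by_cases hA : A = Finset.univ
  · rw [hA, h]
  · rw [← Finset.card_eq_iff_eq_univ] at hA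
    rw [hx A hA, hy A hA]

theorem subsingleton_obj_of_iso {U W : FIMod k m} (e : U ≅ W) {a : FIProd m}
    (h : Subsingleton (U.obj a)) : Subsingleton (W.obj a) :=
  (e.app a).toLinearEquiv.toEquiv.subsingleton_congr.1 h

theorem subsingleton_FIHomology_obj (P : ProjectiveResolution V) {i : ℕ} {a : FIProd m}
    (h : ∀ x, ((P.complex.d (i + 1) i).app a).hom x ∈ (P.complex.X i).lt.carrier a →
      ∃ y, ((P.complex.d (i + 2) (i + 1)).app a).hom y - x ∈
        (P.complex.X (i + 1)).lt.carrier a) :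
    Subsingleton ((FIHomology (i + 1) V).obj a) := by
  let C := ((FIHomZero k m).mapHomologicalComplex _).obj P.complex
  let e : C.homology (i + 1) ≅ (C.sc' (i + 2) (i + 1) i).homology :=
    C.homologyIsoSc' (i + 2) (i + 1) i (ChainComplex.prev ℕ (i + 1)) (ChainComplex.next_nat_succ i)
  refine subsingleton_obj_of_iso ((P.isoLeftDerivedObj (FIHomZero k m) (i + 1)) ≪≫ e).symm ?_
  refine (subsingleton_homology_obj_iff _ a).2 fun x hx => ?_
  obtain ⟨x, rfl⟩ := Submodule.Quotient.mk_surjective _ x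
  obtain ⟨y, hy⟩ := h x ((Submodule.Quotient.mk_eq_zero _).1 hx)
  exact ⟨Submodule.Quotient.mk y, (Submodule.Quotient.eq _).2 hy⟩

/-- A projective resolution, augmented by the module it resolves. -/
noncomputable abbrev augmentedResolution (P : ProjectiveResolution V) :
    ChainComplex (FIMod k m) ℕ :=
  P.complex.augment (P.π.f 0) P.complex_d_comp_π_f_zero

theorem augmentedResolution_exact (P : ProjectiveResolution V) : ∀ q, (ShortComplex.mk _ _
    ((augmentedResolution P).d_comp_d (q + 2) (q + 1) q)).Exact
  | 0 => P.exact₀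
  | q + 1 => P.exact_succ q

theorem koszulExactAt_augmentedResolution (P : ProjectiveResolution V) {i : ℕ}
    (hV : KoszulExactAt V n i) :
    ∀ q p, p + 1 + q = i → KoszulExactAt ((augmentedResolution P).X q) n (p + 1)
  | 0, _, hp => by
    subst hp
    exact hV
  | q + 1, p, _ =>
    have := P.projective q
    koszulExactAt_succ_of_projective (P.complex.X q) n p

theorem subsingleton_FIHomology_of_koszulExactAt {i : ℕ} (hV : KoszulExactAt V n (i + 1)) :
    Subsingleton ((FIHomology (i + 1) V).obj (FIProd.ofVec n)) := by
  rw [← subsetFunctor_obj_univ]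
  let P := ProjectiveResolution.of V
  refine subsingleton_FIHomology_obj P fun x hx => ?_
  rw [FIMod.lt_carrier_eq_range_d] at hx
  obtain ⟨v₀, d_v₀⟩ := hx
  obtain ⟨v, hv, d_v⟩ := exists_homogeneous_d_eq v₀ 0
  obtain ⟨x', hx', eq_x⟩ : ∃ x' ∈ Koszul.homogeneous (P.complex.X (i + 1)) n 0,
      x' Finset.univ = x := by
    refine ⟨Pi.single Finset.univ x, fun A hA => Pi.single_eq_of_ne ?_ _, Pi.single_eq_same _ _⟩
    rintro rfl
    exact hA Finset.card_univ
  have map_x : Koszul.map (P.complex.d (i + 1) i) x' = Koszul.d v := by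
    refine Koszul.eq_of_apply_univ_eq (Koszul.map_mem_homogeneous hx' _)
      (Koszul.d_mem_homogeneous hv) ?_
    rw [Koszul.map_apply, eq_x, d_v _ Finset.card_univ]
    exact d_v₀.symm
  have : Epi ((augmentedResolution P).d 1 0) := inferInstanceAs (Epi (P.π.f 0))
  obtain ⟨y, -, z, -, sum_eq⟩ : ∃ y ∈ Koszul.homogeneous (P.complex.X (i + 2)) n 0,
      ∃ z ∈ Koszul.homogeneous (P.complex.X (i + 1)) n 1,
        Koszul.map (P.complex.d (i + 2) (i + 1)) y + Koszul.d z = x' :=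
    Koszul.exists_map_add_d_eq (E := augmentedResolution P) (augmentedResolution_exact P)
      (koszulExactAt_augmentedResolution P hV) (i + 1) (zero_add _) hx' hv map_x
  have x_eq : ((P.complex.d (i + 2) (i + 1)).app _).hom (y Finset.univ) +
      Koszul.d z Finset.univ = x := (congrFun sum_eq Finset.univ).trans eq_x
  refine ⟨y Finset.univ, ?_⟩
  rw [FIMod.lt_carrier_eq_range_d, ← x_eq, sub_add_cancel_left]
  exact neg_mem ⟨z, rfl⟩

theorem Koszul.map_injective {W : FIMod k m} (φ : V ⟶ W) [Mono φ] :
    Function.Injective (Koszul.map (n := n) φ) := fun x y h => by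
  have mono_app : ∀ a, Mono (φ.app a) := inferInstance
  exact funext fun A => (ModuleCat.mono_iff_injective _).1 (mono_app _) (congrFun h A)

variable [NeZero m]

theorem exists_torsion_eq_of_subsingleton_succ (I : InjectiveResolution V) {q : ℕ} {a : FIProd m}
    (h : Subsingleton ((FILocalCohomology (q + 1) V).obj a)) {t : (I.cocomplex.X (q + 1)).obj a}
    (ht : t ∈ (I.cocomplex.X (q + 1)).torsion.carrier a)
    (hdt : ((I.cocomplex.d (q + 1) (q + 2)).app a).hom t = 0) :
    ∃ s ∈ (I.cocomplex.X q).torsion.carrier a, ((I.cocomplex.d q (q + 1)).app a).hom s = t := by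
  let C := ((BTorsionFunctor k m).mapHomologicalComplex _).obj I.cocomplex
  let e : C.homology (q + 1) ≅ (C.sc' q (q + 1) (q + 2)).homology :=
    C.homologyIsoSc' q (q + 1) (q + 2) (CochainComplex.prev_nat_succ q)
      (CochainComplex.next ℕ (q + 1))
  have subsingleton_homology :=
    subsingleton_obj_of_iso ((I.isoRightDerivedObj (BTorsionFunctor k m) (q + 1)) ≪≫ e) h
  obtain ⟨s, hs⟩ :=
    (subsingleton_homology_obj_iff _ a).1 subsingleton_homology ⟨t, ht⟩ (Subtype.ext hdt)
  exact ⟨s.1, s.2, congrArg Subtype.val hs⟩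

theorem eq_zero_of_subsingleton_zero (I : InjectiveResolution V) {a : FIProd m}
    (h : Subsingleton ((FILocalCohomology 0 V).obj a)) {t : (I.cocomplex.X 0).obj a}
    (ht : t ∈ (I.cocomplex.X 0).torsion.carrier a)
    (hdt : ((I.cocomplex.d 0 1).app a).hom t = 0) : t = 0 := by
  let C := ((BTorsionFunctor k m).mapHomologicalComplex _).obj I.cocomplex
  let e : C.homology 0 ≅ (C.sc' 0 0 1).homology :=
    C.homologyIsoSc' 0 0 1 CochainComplex.prev_nat_zero (CochainComplex.next ℕ 0)
  have subsingleton_homology :=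
    subsingleton_obj_of_iso ((I.isoRightDerivedObj (BTorsionFunctor k m) 0) ≪≫ e) h
  obtain ⟨s, hs⟩ :=
    (subsingleton_homology_obj_iff _ a).1 subsingleton_homology ⟨t, ht⟩ (Subtype.ext hdt)
  have f_eq : (C.sc' 0 0 1).f = 0 := C.shape 0 0 (by simp)
  rw [f_eq] at hs
  exact (congrArg Subtype.val hs).symm

/-- The vanishing of local cohomology in the degrees of the Koszul chains of degree `i` and
above, which controls the exactness of the Koszul complex of `V` at the chains of degree `i`. -/
def LocalCohomologyVanishesFrom (V : FIMod k m) (n : Fin m → ℕ) (i : ℕ) : Prop :=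
  ∀ (q : ℕ) (A : Finset (Pts n)), A.card + (i + q) = Fintype.card (Pts n) →
    Subsingleton ((FILocalCohomology q V).obj ((subsetFunctor n).obj A))

theorem Koszul.exists_torsion_map_eq (I : InjectiveResolution V) {i : ℕ}
    (hV : LocalCohomologyVanishesFrom V n i) (q : ℕ) {t : Koszul (I.cocomplex.X (q + 1)) n}
    (ht : t ∈ Koszul.homogeneous _ n (i + (q + 1)) ⊓ Koszul.torsion _ n)
    (map_t : Koszul.map (I.cocomplex.d (q + 1) (q + 2)) t = 0) :
    ∃ s ∈ Koszul.homogeneous (I.cocomplex.X q) n (i + (q + 1)) ⊓ Koszul.torsion _ n,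
      Koszul.map (I.cocomplex.d q (q + 1)) s = t := by
  obtain ⟨s, hs, hsA⟩ := Koszul.exists_mem_homogeneous (V := I.cocomplex.X q) (n := n)
    (p := i + (q + 1)) (P := fun A v => v ∈ (I.cocomplex.X q).torsion.carrier _ ∧
      ((I.cocomplex.d q (q + 1)).app _).hom v = t A)
    (fun A hA => ⟨zero_mem _, by rw [map_zero, ht.1 A hA]⟩)
    fun A hA => exists_torsion_eq_of_subsingleton_succ I (hV (q + 1) A hA) (ht.2 A trivial)
      (congrFun map_t A)
  exact ⟨s, ⟨hs, fun A _ => (hsA A).1⟩, funext fun A => (hsA A).2⟩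

theorem Koszul.eq_zero_of_mem_torsion (I : InjectiveResolution V) {i : ℕ}
    (hV : LocalCohomologyVanishesFrom V n i) {t : Koszul (I.cocomplex.X 0) n}
    (ht : t ∈ Koszul.homogeneous _ n i ⊓ Koszul.torsion _ n)
    (map_t : Koszul.map (I.cocomplex.d 0 1) t = 0) : t = 0 := by
  funext A
  by_cases hA : A.card + i = Fintype.card (Pts n)
  · exact eq_zero_of_subsingleton_zero I (hV 0 A hA) (ht.2 A trivial) (congrFun map_t A)
  · exact ht.1 A hA

theorem koszulExactAt_succ_of_localCohomology {i : ℕ}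
    (hV : LocalCohomologyVanishesFrom V n (i + 1)) : KoszulExactAt V n (i + 1) := by
  intro x hx hdx
  let I := InjectiveResolution.of V
  have exact_mod_torsion : ∀ q, KoszulExactModTorsionAt (I.cocomplex.X q) n (i + 1 + q) := by
    intro q
    rw [Nat.add_right_comm]
    have := I.injective q
    exact koszulExactModTorsionAt_succ_of_injective (I.cocomplex.X q) n (i + q)
  let ι : V ⟶ I.cocomplex.X 0 := I.ι.f 0
  have : Mono ι := inferInstanceAs (Mono (I.ι.f 0))
  have ι_comp : ι ≫ I.cocomplex.d 0 1 = 0 := I.ι_f_zero_comp_complex_d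
  have d_map_x : Koszul.d (Koszul.map ι x) = 0 := by rw [← Koszul.map_d, hdx, map_zero]
  obtain ⟨t, ht, y, hy, map_t, map_y, sum_eq⟩ := Koszul.exists_mem_torsion_add_d_eq
    I.exact_succ exact_mod_torsion (fun q _ => Koszul.exists_torsion_map_eq I hV q) 0
    (Koszul.map_mem_homogeneous hx ι) (Koszul.map_map_eq_zero ι_comp x)
    (d_map_x ▸ zero_mem _)
  obtain ⟨w, hw, map_w⟩ := Koszul.exists_map_eq_of_exact
    (S := ShortComplex.mk ι (I.cocomplex.d 0 1) ι_comp) I.exact₀ hy map_y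
  rw [Koszul.eq_zero_of_mem_torsion I hV ht map_t, zero_add, ← map_w, ← Koszul.map_d] at sum_eq
  exact ⟨w, hw, Koszul.map_injective ι sum_eq⟩

end Derived

section Region

variable {m : ℕ} {n : Fin m → ℕ}

theorem sum_card_ptsFiber (A : Finset (Pts n)) : ∑ j, (ptsFiber A j).card = A.card := by
  rw [← Finset.card_sigma]
  congr 1
  ext ⟨j, i⟩
  simp [mem_ptsFiber]

theorem card_ptsFiber_sdiff {A B : Finset (Pts n)} (h : A ⊆ B) (j : Fin m) :
    (ptsFiber A j).card + (ptsFiber (B \ A) j).card = (ptsFiber B j).card := by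
  have fiber_sdiff : ptsFiber (B \ A) j = ptsFiber B j \ ptsFiber A j := by
    ext i
    simp only [mem_ptsFiber, Finset.mem_sdiff]
  rw [fiber_sdiff, add_comm, Finset.card_sdiff_add_card_eq_card (ptsFiber_mono h j)]

theorem sub_mem_positiveStep {r v : Fin m → ℤ} (hv : v ∈ positiveStep r) (w : Fin m → ℤ) :
    v - w ∈ positiveStep (r - w) := by
  obtain ⟨j, p, rfl⟩ := hv
  exact ⟨j, p, by abel⟩

variable {k : Type u} [CommRing k] [NeZero m] {V : FIMod k m}

theorem localCohomologyVanishesFrom_of_mem_CMregPos {i : ℕ} {c : Fin m → ℤ}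
    (hc : ∀ a : Fin m → ℕ, ∑ j, a j = i → (c - fun l => (a l : ℤ)) ∈ CMregPos V)
    (hn : (fun l => (n l : ℤ)) ∈ positiveStep c) : LocalCohomologyVanishesFrom V n i := by
  intro q A hA
  obtain ⟨B, hAB, -, card_B⟩ := Finset.exists_subsuperset_card_eq A.subset_univ
    (n := A.card + q) (by omega) (by rw [Finset.card_univ]; omega)
  have card_compl : (Finset.univ \ B).card = i := by
    rw [Finset.card_sdiff_of_subset B.subset_univ, Finset.card_univ]
    omega
  have card_sdiff : (B \ A).card = q := by
    rw [Finset.card_sdiff_of_subset hAB]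
    omega
  have fiber_eq : (fun l => ((ptsFiber A l).card : ℤ)) = (fun l => (n l : ℤ)) -
      (fun l => ((ptsFiber (Finset.univ \ B) l).card : ℤ)) -
        fun l => ((ptsFiber (B \ A) l).card : ℤ) := by
    funext l
    have card_A := card_ptsFiber_sdiff hAB l
    have card_univ := card_ptsFiber_sdiff B.subset_univ l
    have card_fiber_univ : (ptsFiber (Finset.univ : Finset (Pts n)) l).card = n l := by
      simp [ptsFiber]
    simp only [Pi.sub_apply]
    omega
  refine hc _ ((sum_card_ptsFiber _).trans card_compl) q _ ((sum_card_ptsFiber _).trans card_sdiff)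
    (fun l => ((ptsFiber A l).card : ℤ)) ?_ _ fun _ => rfl
  rw [fiber_eq]
  exact sub_mem_positiveStep (sub_mem_positiveStep hn _) _

end Region

theorem mainTheorem2_general {k : Type u} [CommRing k] {m : ℕ} [NeZero m] (V : FIMod k m) (i : ℕ)
    (hi : 1 ≤ i) (c : Fin m → ℤ)
    (hc : ∀ a : Fin m → ℕ, ∑ j, a j = i → (c - fun l => (a l : ℤ)) ∈ CMregPos V) :
    c ∈ HD i V := by
  intro v hv n hn
  obtain rfl : (fun l => (n l : ℤ)) = v := funext hn
  obtain ⟨i, rfl⟩ := Nat.exists_eq_add_of_le' hi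
  have vanishing : LocalCohomologyVanishesFrom V n (i + 1) :=
    localCohomologyVanishesFrom_of_mem_CMregPos hc hv
  have koszul_exact : KoszulExactAt V n (i + 1) := koszulExactAt_succ_of_localCohomology vanishing
  exact subsingleton_FIHomology_of_koszulExactAt koszul_exact

theorem mainTheorem2 {k : Type u} [CommRing k] [IsNoetherianRing k] {m : ℕ} [NeZero m]
    (V : FIMod k m) (hV : V.IsFG) (i : ℕ) (hi : 1 ≤ i) (c : Fin m → ℤ)
    (hc : ∀ a : Fin m → ℕ, ∑ j, a j = i → (c - fun l => (a l : ℤ)) ∈ CMregPos V) :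
    c ∈ HD i V :=
  mainTheorem2_general V i hi c hc
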